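/- Let $M$ be a compact smooth manifold (without boundary) of dimension $2n+1$ with a contact form $\alpha$, i.e. a smooth one-form such that $\nu_\alpha=\alpha\wedge(d\alpha)^n$ is a volume form. For $f\in C^0(M)$ put $\|f\|=\max f-\min f+\left|\int_M f\,\nu_\alpha\right|$. A strictly contact isotopy is a smooth map $\phi:M\times[0,1]\to M$, $(x,t)\mapsto\phi_t(x)$, such that every $\phi_t$ is a diffeomorphism, $\phi_0=\mathrm{id}$, and the vector fields $\dot\phi_t(x)=\frac{d\phi_t}{dt}(\phi_t^{-1}(x))$ satisfy $L_{\dot\phi_t}\alpha=0$ for all $t$; its generator is the function $H_t=\alpha(\dot\phi_t)$. Let $\mathcal H$ be the set of continuous paths $[0,1]\to\mathrm{Homeo}(M)$ starting at the identity, with the metric $\overline d(\lambda,\mu)=\sup_{t}\max\{\sup_x d_0(\lambda_t(x),\mu_t(x)),\ \sup_x d_0(\lambda_t^{-1}(x),\mu_t^{-1}(x))\}$, where $d_0$ is a metric inducing the topology of $M$ (and $\mathrm{Homeo}(M)$ carries the corresponding $C^0$ topology). Let $L^{(1,\infty)}$ be the completion of $C^\infty(M\times[0,1],\mathbb R)$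 with respect to $\|H\|_{(1,\infty)}=\int_0^1\|H_t\|\,dt$, that is, the space $L^1([0,1],C^0(M))$. Let $\mathcal{Q_S}\subset \mathcal H\times L^{(1,\infty)}$ be the set of pairs $(\phi,H)$ of a strictly contact isotopy $\phi$ and its generator $H$, and let $\overline{\mathcal{Q_S}}$ be its closure in the product topology. Theorem. The operations $$(\phi,H)\cdot(\psi,F)=(\phi_t\circ\psi_t,\ H_t+F_t\circ\phi_t^{-1}),\qquad (\phi,H)^{-1}=(\phi_t^{-1},\ -H_t\circ\phi_t)$$ map $\overline{\mathcal{Q_S}}$ to itself and make it a topological group for the contact topology, i.e. the topology of the contact distance $$d_{\rm cont}((\phi,H),(\psi,F))=\overline d(\phi,\psi)+\int_0^1\left(\|H_t-F_t\|+\|H_t\circ\phi_t-F_t\circ\psi_t\|\right)dt ,$$ which coincides on $\overline{\mathcal{Q_S}}$ with the subspace topology of the product $\mathcal H\times L^{(1,\infty)}$. -/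

import Mathlib

open scoped Manifold ContDiff
open MeasureTheory

noncomputable section

namespace ContactTopology

/-- The model space `ℝ^(2n+1)`. -/
abbrev E (n : ℕ) : Type := EuclideanSpace ℝ (Fin (2 * n + 1))

/-! ### One-forms, contact forms and contact vector fields -/

section Forms

variable {n : ℕ} {M : Type*} [TopologicalSpace M] [ChartedSpace (E n) M]

/-- A (not necessarily smooth) one-form on `M`. -/
abbrev OneForm (n : ℕ) (M : Type*) [TopologicalSpace M] [ChartedSpace (E n) M] :=
  (x : M) → (TangentSpace 𝓘(ℝ, E n) x →L[ℝ] ℝ)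

/-- A (not necessarily smooth) vector field on `M`. -/
abbrev VectorField (n : ℕ) (M : Type*) [TopologicalSpace M] [ChartedSpace (E n) M] :=
  (x : M) → TangentSpace 𝓘(ℝ, E n) x

/-- The expression `(e⁻¹)^* α` of a one-form in a chart `e`; meaningful on `e.target`. -/
def OneForm.inChart (α : OneForm n M) (e : OpenPartialHomeomorph M (E n)) :
    E n → (E n →L[ℝ] ℝ) :=
  fun y => (α (e.symm y)).comp (mfderiv 𝓘(ℝ, E n) 𝓘(ℝ, E n) e.symm y)

/-- The expression `e_* X` of a vector field in a chart `e`; meaningful on `e.target`. -/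
def VectorField.inChart (X : VectorField n M) (e : OpenPartialHomeomorph M (E n)) :
    E n → E n :=
  fun y => mfderiv 𝓘(ℝ, E n) 𝓘(ℝ, E n) e (e.symm y) (X (e.symm y))

/-- Smoothness of a one-form: its expression in every chart of the smooth structure is smooth. -/
def OneForm.IsSmooth (α : OneForm n M) : Prop :=
  ∀ e ∈ IsManifold.maximalAtlas 𝓘(ℝ, E n) ∞ M, ContDiffOn ℝ ∞ (α.inChart e) e.target

/-- The exterior derivative `dα`, in the chart `e`, at `y`:
`dα(u, v) = (∂_u α)(v) - (∂_v α)(u)`. -/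
def OneForm.dInChart (α : OneForm n M) (e : OpenPartialHomeomorph M (E n)) (y u v : E n) : ℝ :=
  fderiv ℝ (α.inChart e) y u v - fderiv ℝ (α.inChart e) y v u

/-- The value at `y`, in the chart `e`, of the top-degree form `α ∧ (dα)^n` on the standard
basis `∂_0, …, ∂_{2n}`:
`2^{-n} ∑_σ sgn(σ) α(∂_σ(0)) dα(∂_σ(1), ∂_σ(2)) ⋯ dα(∂_σ(2n-1), ∂_σ(2n))`. -/
def OneForm.volInChart (α : OneForm n M) (e : OpenPartialHomeomorph M (E n)) (y : E n) : ℝ :=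
  (1 / 2 ^ n : ℝ) * ∑ σ : Equiv.Perm (Fin (2 * n + 1)),
    ((Equiv.Perm.sign σ : ℤ) : ℝ) *
      (α.inChart e y (EuclideanSpace.single (σ 0) 1) *
        ∏ i : Fin n,
          α.dInChart e y
            (EuclideanSpace.single (σ ⟨2 * (i : ℕ) + 1, by omega⟩) 1)
            (EuclideanSpace.single (σ ⟨2 * (i : ℕ) + 2, by omega⟩) 1))

/-- A contact form: a smooth one-form `α` such that `α ∧ (dα)^n` vanishes nowhere. -/
structure IsContactForm (α : OneForm n M) : Prop where
  smooth : α.IsSmooth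
  nondegenerate : ∀ e ∈ IsManifold.maximalAtlas 𝓘(ℝ, E n) ∞ M, ∀ y ∈ e.target,
    α.volInChart e y ≠ 0

/-- The measure of the volume form `ν_α = α ∧ (dα)^n` on `M`, oriented by itself.
In the domain of a chart `e` it is Lebesgue measure in the chart with density `|ν_α(∂_0, …, ∂_2n)|`.
These chart measures agree on overlaps, and their least upper bound is the measure on `M` which
restricts to each of them. -/
def contactVolume [MeasurableSpace M] (α : OneForm n M) : Measure M :=
  ⨆ e ∈ IsManifold.maximalAtlas 𝓘(ℝ, E n) ∞ M,
    (((volume : Measure (E n)).restrict e.target).withDensity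
      (fun y => ENNReal.ofReal |α.volInChart e y|)).map e.symm

/-- `X` is a strictly contact vector field: `L_X α = 0`. The Lie derivative is written in charts,
`(L_X α)(v) = (∂_X α)(v) + α(∂_v X)` for constant `v`. -/
def IsStrictlyContactField (α : OneForm n M) (X : VectorField n M) : Prop :=
  ∀ e ∈ IsManifold.maximalAtlas 𝓘(ℝ, E n) ∞ M, ∀ y ∈ e.target, ∀ v : E n,
    fderiv ℝ (α.inChart e) y (X.inChart e y) v
      + α.inChart e y (fderiv ℝ (X.inChart e) y v) = 0

end Forms

/-! ### Paths of homeomorphisms and the `C^0` topology -/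

section Paths

variable {M : Type*} [MetricSpace M] [CompactSpace M]

/-- The metric on `Homeo(M)`:
`d(h, g) = max (sup_x d₀(h x, g x)) (sup_x d₀(h⁻¹ x, g⁻¹ x))`, obtained from the sup metric on
`C(M, M)` and the max metric on the product. -/
instance homeoMetricSpace : MetricSpace (M ≃ₜ M) :=
  MetricSpace.induced
    (fun h : M ≃ₜ M => ((h : C(M, M)), (h.symm : C(M, M))))
    (fun h g hg => by
      ext x
      exact DFunLike.congr_fun (congrArg Prod.fst hg) x)
    inferInstance

/-- Continuous paths `[0,1] → Homeo(M)` starting at the identity, with the metric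
`d(λ, μ) = sup_t d(λ_t, μ_t)`. -/
abbrev HomeoPath (M : Type*) [MetricSpace M] [CompactSpace M] : Type _ :=
  {γ : C(unitInterval, M ≃ₜ M) // γ 0 = Homeomorph.refl M}

end Paths

/-! ### Strictly contact isotopies -/

section Isotopies

variable {n : ℕ} {M : Type*} [MetricSpace M] [CompactSpace M] [ChartedSpace (E n) M]

/-- The path of homeomorphisms `φ` is an isotopy: `(x, t) ↦ φ_t x` is smooth on `M × [0,1]`, every
`φ_t` is a diffeomorphism (and `φ_0 = id`, as for every element of `HomeoPath M`). -/
def IsIsotopy (n : ℕ) {M : Type*} [MetricSpace M] [CompactSpace M] [ChartedSpace (E n) M]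
    (φ : HomeoPath M) : Prop :=
  ContMDiffOn (𝓘(ℝ, E n).prod 𝓘(ℝ, ℝ)) 𝓘(ℝ, E n) ∞
      (fun p : M × ℝ => φ.1 (Set.projIcc 0 1 zero_le_one p.2) p.1)
      (Set.univ ×ˢ Set.Icc 0 1) ∧
    ∀ t : unitInterval, ContMDiff 𝓘(ℝ, E n) 𝓘(ℝ, E n) ∞ (φ.1 t).symm

/-- The vector field `φ̇_t(x) = (dφ_t/dt)(φ_t⁻¹ x)` of an isotopy (one-sided derivative at the
ends of `[0,1]`). -/
def velocity (n : ℕ) {M : Type*} [MetricSpace M] [CompactSpace M] [ChartedSpace (E n) M]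
    (φ : HomeoPath M) (t : unitInterval) : VectorField n M :=
  fun x => (mfderivWithin 𝓘(ℝ, ℝ) 𝓘(ℝ, E n)
    (fun s : ℝ => φ.1 (Set.projIcc 0 1 zero_le_one s) ((φ.1 t).symm x))
    (Set.Icc 0 1) (t : ℝ) (1 : ℝ) : E n)

/-- Strictly contact isotopies of `(M, α)`. -/
def IsStrictlyContactIsotopy (α : OneForm n M) (φ : HomeoPath M) : Prop :=
  IsIsotopy n φ ∧ ∀ t, IsStrictlyContactField α (velocity n φ t)

/-- The generator `H_t = α(φ̇_t)` of an isotopy. -/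
def generator (α : OneForm n M) (φ : HomeoPath M) (t : unitInterval) (x : M) : ℝ :=
  α x (velocity n φ t x)

end Isotopies

/-! ### The contact topology -/

section Topology

/-- The topology of open balls of a distance function. -/
@[reducible] def distTopology {X : Type*} (d : X → X → ℝ) : TopologicalSpace X where
  IsOpen U := ∀ x ∈ U, ∃ ε > 0, ∀ y, d x y < ε → y ∈ U
  isOpen_univ := fun _ _ => ⟨1, one_pos, fun _ _ => trivial⟩
  isOpen_inter := by
    rintro U V hU hV x ⟨hxU, hxV⟩
    obtain ⟨a, ha, hUa⟩ := hU x hxU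
    obtain ⟨b, hb, hVb⟩ := hV x hxV
    exact ⟨min a b, lt_min ha hb, fun y hy =>
      ⟨hUa y (hy.trans_le (min_le_left a b)), hVb y (hy.trans_le (min_le_right a b))⟩⟩
  isOpen_sUnion := by
    rintro S hS x ⟨U, hU, hx⟩
    obtain ⟨a, ha, hUa⟩ := hS U hU x hx
    exact ⟨a, ha, fun y hy => ⟨U, hU, hUa y hy⟩⟩

/-- Hamiltonians of class `L^(1,∞)`: (classes of) integrable families `t ↦ H_t ∈ C^0(M)`,
`t ∈ [0,1]`, `C^0(M)` having the sup norm. It contains the smooth functions on `M × [0,1]` as a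
dense subspace and is their `L^(1,∞)` completion. -/
abbrev L1Infty (M : Type*) [TopologicalSpace M] [CompactSpace M] : Type _ :=
  Lp C(M, ℝ) 1 (volume : Measure unitInterval)

variable {n : ℕ} {M : Type*} [MetricSpace M] [CompactSpace M] [ChartedSpace (E n) M]
  [MeasurableSpace M]

/-- `osc f = max f - min f`. -/
def osc (f : C(M, ℝ)) : ℝ := (⨆ x, f x) - ⨅ x, f x

/-- The norm `osc f + |∫_M f ν_α|`. -/
def contactNorm (α : OneForm n M) (f : C(M, ℝ)) : ℝ :=
  osc f + |∫ x, f x ∂(contactVolume α)|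

/-- `‖H - F‖ = ∫_0^1 (osc (H_t - F_t) + |∫_M (H_t - F_t) ν_α|) dt`. -/
def hamDist (α : OneForm n M) (H F : L1Infty M) : ℝ :=
  ∫ t, contactNorm α (H t - F t)

/-- The product topology on `L^(1,∞) × (C^0 paths of homeomorphisms)`. -/
@[reducible] def pairTopology (α : OneForm n M) : TopologicalSpace (HomeoPath M × L1Infty M) :=
  @instTopologicalSpaceProd _ _ inferInstance (distTopology (hamDist α))

/-- The generator at time `t` of the inverse isotopy, `-H_t ∘ φ_t`. -/
def invHam (p : HomeoPath M × L1Infty M) (t : unitInterval) : C(M, ℝ) :=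
  -(p.2 t).comp (p.1.1 t : C(M, M))

/-- The contact distance `d(φ, ψ) + ∫_0^1 (‖H_t - F_t‖ + ‖(-H_t ∘ φ_t) - (-F_t ∘ ψ_t)‖) dt`. -/
def contactDist (α : OneForm n M) (p q : HomeoPath M × L1Infty M) : ℝ :=
  dist p.1 q.1 +
    ∫ t, (contactNorm α (p.2 t - q.2 t) + contactNorm α (invHam p t - invHam q t))

/-- The set `Q_S` of pairs (strictly contact isotopy, its generator). -/
def QS (α : OneForm n M) : Set (HomeoPath M × L1Infty M) :=
  {p | IsStrictlyContactIsotopy α p.1 ∧ ∀ᵐ t : unitInterval, ∀ x, p.2 t x = generator α p.1 t x}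

/-- The closure of `Q_S` in `L^(1,∞) × (C^0 paths of homeomorphisms)`. -/
def QSbar (α : OneForm n M) : Set (HomeoPath M × L1Infty M) :=
  @closure _ (pairTopology α) (QS α)

/-- The topology which the closure of `Q_S` has as a subspace of the product. -/
@[reducible] def productTopologyQSbar (α : OneForm n M) : TopologicalSpace (QSbar α) :=
  (pairTopology α).induced Subtype.val

/-- The contact topology on the closure of `Q_S`: the topology of the contact distance. -/
@[reducible] def contactTopologyQSbar (α : OneForm n M) : TopologicalSpace (QSbar α) :=
  distTopology (fun p q : QSbar α => contactDist α p.1 q.1)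

end Topology

end ContactTopology

end

/-!
Paths of homeomorphisms act on Hamiltonians by `H ↦ H ∘ φ`, and the two operations of the theorem
are those of the semidirect product `HomeoPath M ⋉ L^(1,∞)` (`pairGroup`), a group containing all
pairs. The action is isometric for the `L^1` norm over the sup norm of `C(M, ℝ)`, and its orbit maps
are continuous by dominated convergence, so it is jointly continuous (`continuous_compHam`) and the
semidirect product is a topological group (`isTopologicalGroup_pairGroup`). The closure of a
subgroup of a topological group is a topological group, and it remains to see that the topologies
agree and that `QS α` is a subgroup.

For the topologies, the contact norm is equivalent to the sup norm as soon as the contact volume is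
finite and nonzero (`contactNorm_le`, `norm_le_contactNorm`). This holds because the density of the
volume form is multiplied by the Jacobian determinant under a change of charts
(`volInChart_transition`), so that near every point the supremum of the chart measures is one of
them (`contactVolume_le`), while the contact condition makes the density nonzero. Hence the
distances `hamDist` and `contactDist` may be computed with sup norms; the second Hamiltonian term of
`contactDist` is continuous because composition is, and does not change the topology
(`distTopology_contactDist`).

For the subgroup property, the formula `d/dt (φ_t^* α) = φ_t^* (L_{X_t} α)`
(`hasDerivWithinAt_pullback`) shows that an isotopy with velocity `X_t` is strictly contact exactly
when every `φ_t` preserves `α` (`isStrictlyContactIsotopy_iff`), a condition stable under composition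
and inversion. The chain rule then gives the generator of a composition (`generator_mul`). The
smoothness of the inverse isotopy (`isIsotopy_inv`) is an inverse function theorem on the
manifold with boundary `M × [0,1]`, which is why derivatives are taken within `repDomain`.
-/

noncomputable section

namespace ContactTopology

open Filter Topology

/-! ### The group of pairs: paths of homeomorphisms acting on Hamiltonians -/

section HomeoGroup

variable {M : Type*} [MetricSpace M] [CompactSpace M]

theorem isEmbedding_homeo_pair :
    IsEmbedding (fun h : M ≃ₜ M => ((h : C(M, M)), (h.symm : C(M, M)))) where
  eq_induced := rfl
  injective h g hg := by
    ext x
    exact DFunLike.congr_fun (congrArg Prod.fst hg) x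

theorem continuous_homeo_toContinuousMap : Continuous (fun h : M ≃ₜ M => (h : C(M, M))) :=
  continuous_fst.comp isEmbedding_homeo_pair.continuous

theorem continuous_homeo_symm_toContinuousMap :
    Continuous (fun h : M ≃ₜ M => (h.symm : C(M, M))) :=
  continuous_snd.comp isEmbedding_homeo_pair.continuous

instance homeo_isTopologicalGroup : IsTopologicalGroup (M ≃ₜ M) where
  continuous_mul := by
    refine isEmbedding_homeo_pair.continuous_iff.2 (Continuous.prodMk ?_ ?_)
    · exact (continuous_homeo_toContinuousMap.comp continuous_fst).compCM
        (continuous_homeo_toContinuousMap.comp continuous_snd)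
    · exact (continuous_homeo_symm_toContinuousMap.comp continuous_snd).compCM
        (continuous_homeo_symm_toContinuousMap.comp continuous_fst)
  continuous_inv := isEmbedding_homeo_pair.continuous_iff.2
    (continuous_homeo_symm_toContinuousMap.prodMk continuous_homeo_toContinuousMap)

/-- The continuous paths in `Homeo(M)` which start at the identity, as a subgroup of the group of
all continuous paths under pointwise composition. -/
def homeoPathSubgroup (M : Type*) [MetricSpace M] [CompactSpace M] :
    Subgroup C(unitInterval, M ≃ₜ M) where
  carrier := {γ | γ 0 = Homeomorph.refl M}
  mul_mem' {a b} ha hb := by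
    change a 0 * b 0 = 1
    rw [show a 0 = 1 from ha, show b 0 = 1 from hb, one_mul]
  one_mem' := rfl
  inv_mem' {a} ha := by
    change (a 0)⁻¹ = 1
    rw [show a 0 = 1 from ha, inv_one]

instance continuousMap_homeo_isTopologicalGroup : IsTopologicalGroup C(unitInterval, M ≃ₜ M) where
  continuous_inv :=
    ContinuousMap.continuous_postcomp (⟨fun h => h⁻¹, continuous_inv⟩ : C(M ≃ₜ M, M ≃ₜ M))

instance homeoPathGroup : Group (HomeoPath M) :=
  inferInstanceAs (Group (homeoPathSubgroup M))

instance homeoPath_isTopologicalGroup : IsTopologicalGroup (HomeoPath M) :=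
  inferInstanceAs (IsTopologicalGroup (homeoPathSubgroup M))

end HomeoGroup

section Action

variable {M : Type*} [MetricSpace M] [CompactSpace M]

theorem continuous_homeoPath_toContinuousMap (φ : HomeoPath M) :
    Continuous fun t => (φ.1 t : C(M, M)) :=
  continuous_homeo_toContinuousMap.comp φ.1.continuous

theorem norm_comp_homeo (f : C(M, ℝ)) (h : M ≃ₜ M) : ‖f.comp (h : C(M, M))‖ = ‖f‖ := by
  refine le_antisymm ?_ ?_
  · exact (ContinuousMap.norm_le _ (norm_nonneg _)).2 fun x => f.norm_coe_le_norm (h x)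
  · refine (ContinuousMap.norm_le _ (norm_nonneg _)).2 fun x => ?_
    simpa using (f.comp (h : C(M, M))).norm_coe_le_norm (h.symm x)

theorem memLp_comp (H : L1Infty M) (φ : HomeoPath M) :
    MemLp (fun t => (H t).comp (φ.1 t : C(M, M))) 1 (volume : Measure unitInterval) := by
  have hmeas : AEStronglyMeasurable (fun t => (H t).comp (φ.1 t : C(M, M)))
      (volume : Measure unitInterval) := by
    have hcont : Continuous fun p : C(M, ℝ) × unitInterval => p.1.comp (φ.1 p.2 : C(M, M)) :=
      continuous_fst.compCM ((continuous_homeoPath_toContinuousMap φ).comp continuous_snd)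
    exact hcont.comp_aestronglyMeasurable
      ((Lp.aestronglyMeasurable H).prodMk continuous_id.aestronglyMeasurable)
  exact (Lp.memLp H).of_le hmeas (Eventually.of_forall fun t => (norm_comp_homeo _ _).le)

/-- The Hamiltonian `t ↦ H_t ∘ φ_t`. -/
def compHam (H : L1Infty M) (φ : HomeoPath M) : L1Infty M := (memLp_comp H φ).toLp _

theorem coeFn_compHam (H : L1Infty M) (φ : HomeoPath M) :
    compHam H φ =ᵐ[volume] fun t => (H t).comp (φ.1 t : C(M, M)) :=
  (memLp_comp H φ).coeFn_toLp

theorem compHam_add (H F : L1Infty M) (φ : HomeoPath M) :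
    compHam (H + F) φ = compHam H φ + compHam F φ := by
  apply Lp.ext
  filter_upwards [coeFn_compHam (H + F) φ, coeFn_compHam H φ, coeFn_compHam F φ,
    Lp.coeFn_add H F, Lp.coeFn_add (compHam H φ) (compHam F φ)] with t h1 h2 h3 h4 h5
  rw [h1, h5, h4]
  simp only [Pi.add_apply, h2, h3]
  rfl

theorem compHam_neg (H : L1Infty M) (φ : HomeoPath M) : compHam (-H) φ = -compHam H φ := by
  apply Lp.ext
  filter_upwards [coeFn_compHam (-H) φ, coeFn_compHam H φ,
    Lp.coeFn_neg H, Lp.coeFn_neg (compHam H φ)] with t h1 h2 h4 h5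
  rw [h1, h5, h4]
  simp only [Pi.neg_apply, h2]
  rfl

theorem compHam_sub (H F : L1Infty M) (φ : HomeoPath M) :
    compHam (H - F) φ = compHam H φ - compHam F φ := by
  rw [sub_eq_add_neg, compHam_add, compHam_neg, sub_eq_add_neg]

theorem compHam_one (H : L1Infty M) : compHam H 1 = H := by
  apply Lp.ext
  filter_upwards [coeFn_compHam H 1] with t h1
  rw [h1]
  rfl

theorem compHam_compHam (H : L1Infty M) (φ ψ : HomeoPath M) :
    compHam (compHam H φ) ψ = compHam H (φ * ψ) := by
  apply Lp.ext
  filter_upwards [coeFn_compHam (compHam H φ) ψ, coeFn_compHam H φ,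
    coeFn_compHam H (φ * ψ)] with t h1 h2 h3
  rw [h1, h2, h3]
  rfl

theorem norm_compHam (H : L1Infty M) (φ : HomeoPath M) : ‖compHam H φ‖ = ‖H‖ := by
  rw [Lp.norm_def, Lp.norm_def]
  congr 1
  refine eLpNorm_congr_norm_ae ?_
  filter_upwards [coeFn_compHam H φ] with t h
  rw [h, norm_comp_homeo]

theorem continuous_eval_homeoPath (t : unitInterval) :
    Continuous fun φ : HomeoPath M => (φ.1 t : C(M, M)) :=
  continuous_homeo_toContinuousMap.comp
    ((continuous_eval_const t).comp continuous_subtype_val)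

/-- Orbit maps of the action of paths on Hamiltonians are continuous, by dominated convergence. -/
theorem continuous_compHam_right (H : L1Infty M) : Continuous fun φ : HomeoPath M => compHam H φ := by
  refine continuous_iff_continuousAt.2 fun φ => ?_
  have hint : Integrable (fun t => ‖H t‖) (volume : Measure unitInterval) :=
    (memLp_one_iff_integrable.1 (Lp.memLp H)).norm
  have hnorm : ∀ ψ : HomeoPath M, dist (compHam H ψ) (compHam H φ) =
      ∫ t, ‖(H t).comp (ψ.1 t : C(M, M)) - (H t).comp (φ.1 t : C(M, M))‖ := by
    intro ψ
    rw [dist_eq_norm, L1.norm_eq_integral_norm]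
    refine integral_congr_ae ?_
    filter_upwards [coeFn_compHam H ψ, coeFn_compHam H φ,
      Lp.coeFn_sub (compHam H ψ) (compHam H φ)] with t h1 h2 h3
    rw [h3, Pi.sub_apply, h1, h2]
  refine tendsto_iff_dist_tendsto_zero.2 ?_
  simp only [hnorm]
  have := tendsto_integral_filter_of_dominated_convergence
    (μ := (volume : Measure unitInterval)) (l := 𝓝 φ)
    (F := fun (ψ : HomeoPath M) t =>
      ‖(H t).comp (ψ.1 t : C(M, M)) - (H t).comp (φ.1 t : C(M, M))‖)
    (f := fun _ => (0 : ℝ)) (fun t => 2 * ‖H t‖)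
    (Eventually.of_forall fun ψ =>
      ((memLp_comp H ψ).aestronglyMeasurable.sub (memLp_comp H φ).aestronglyMeasurable).norm)
    (Eventually.of_forall fun ψ => Eventually.of_forall fun t => ?_)
    (hint.const_mul 2) (Eventually.of_forall fun t => ?_)
  · simpa using this
  · rw [norm_norm]
    refine (norm_sub_le _ _).trans_eq ?_
    rw [norm_comp_homeo, norm_comp_homeo, two_mul]
  · have hc : Continuous fun ψ : HomeoPath M =>
        ‖(H t).comp (ψ.1 t : C(M, M)) - (H t).comp (φ.1 t : C(M, M))‖ :=
      ((continuous_const.compCM (continuous_eval_homeoPath t)).sub continuous_const).norm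
    simpa using hc.tendsto φ

/-- Composition is jointly continuous, the action being isometric in the Hamiltonian. -/
theorem continuous_compHam :
    Continuous fun p : L1Infty M × HomeoPath M => compHam p.1 p.2 := by
  refine continuous_iff_continuousAt.2 fun ⟨H, φ⟩ => ?_
  refine tendsto_iff_dist_tendsto_zero.2 ?_
  have hbound : ∀ p : L1Infty M × HomeoPath M, dist (compHam p.1 p.2) (compHam H φ) ≤
      dist p.1 H + dist (compHam H p.2) (compHam H φ) := by
    intro p
    refine (dist_triangle _ (compHam H p.2) _).trans_eq ?_
    rw [dist_eq_norm, ← compHam_sub, norm_compHam, ← dist_eq_norm]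
  refine squeeze_zero (fun _ => dist_nonneg) hbound ?_
  have hc : Continuous fun p : L1Infty M × HomeoPath M =>
      dist p.1 H + dist (compHam H p.2) (compHam H φ) :=
    (continuous_fst.dist continuous_const).add
      (((continuous_compHam_right H).comp continuous_snd).dist continuous_const)
  simpa using hc.tendsto (H, φ)

/-- The group `HomeoPath M ⋉ L^(1,∞)` in which the strictly contact pairs live:
`(φ, H) (ψ, F) = (φ ψ, H + F ∘ φ⁻¹)`. -/
@[reducible] def pairGroup (M : Type*) [MetricSpace M] [CompactSpace M] :
    Group (HomeoPath M × L1Infty M) :=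
  letI : Mul (HomeoPath M × L1Infty M) := ⟨fun p q => (p.1 * q.1, p.2 + compHam q.2 p.1⁻¹)⟩
  letI : One (HomeoPath M × L1Infty M) := ⟨(1, 0)⟩
  letI : Inv (HomeoPath M × L1Infty M) := ⟨fun p => (p.1⁻¹, -compHam p.2 p.1)⟩
  Group.ofLeftAxioms
    (by
      rintro ⟨φ, H⟩ ⟨ψ, F⟩ ⟨χ, K⟩
      change (φ * ψ * χ, H + compHam F φ⁻¹ + compHam K (φ * ψ)⁻¹) =
        (φ * (ψ * χ), H + compHam (F + compHam K ψ⁻¹) φ⁻¹)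
      rw [compHam_add, compHam_compHam, mul_inv_rev, mul_assoc, add_assoc])
    (by
      rintro ⟨φ, H⟩
      change (1 * φ, 0 + compHam H 1⁻¹) = (φ, H)
      rw [one_mul, zero_add, inv_one, compHam_one])
    (by
      rintro ⟨φ, H⟩
      change (φ⁻¹ * φ, -compHam H φ + compHam H φ⁻¹⁻¹) = (1, 0)
      rw [inv_inv, inv_mul_cancel, neg_add_cancel])

theorem isTopologicalGroup_pairGroup :
    @IsTopologicalGroup (HomeoPath M × L1Infty M) inferInstance (pairGroup M) :=
  letI := pairGroup M
  { continuous_mul := by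
      change Continuous fun x : (HomeoPath M × L1Infty M) × (HomeoPath M × L1Infty M) =>
        (x.1.1 * x.2.1, x.1.2 + compHam x.2.2 x.1.1⁻¹)
      exact (continuous_fst.fst.mul continuous_snd.fst).prodMk
        (continuous_fst.snd.add (continuous_compHam.comp
          (continuous_snd.snd.prodMk continuous_fst.fst.inv)))
    continuous_inv := by
      change Continuous fun x : HomeoPath M × L1Infty M => (x.1⁻¹, -compHam x.2 x.1)
      exact continuous_fst.inv.prodMk
        (continuous_compHam.comp (continuous_snd.prodMk continuous_fst)).neg }

end Action

/-! ### The contact norm and the contact distance -/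

section Norms

/-- A distance function has a given topology as its topology of balls when it is continuous at the
diagonal and its balls are small. No triangle inequality is needed. -/
theorem distTopology_eq {X : Type*} [T : TopologicalSpace X] (d : X → X → ℝ)
    (h₁ : ∀ x, Tendsto (d x) (𝓝 x) (𝓝 0))
    (h₂ : ∀ x, ∀ U ∈ 𝓝 x, ∃ ε > 0, ∀ y, d x y < ε → y ∈ U) : distTopology d = T := by
  refine TopologicalSpace.ext_iff.2 fun U => ⟨fun hU => ?_, fun hU x hx => h₂ x U (hU.mem_nhds hx)⟩
  refine isOpen_iff_mem_nhds.2 fun x hx => ?_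
  obtain ⟨ε, hε, hU⟩ := hU x hx
  filter_upwards [(h₁ x).eventually_lt_const hε] with y hy using hU y hy

variable {n : ℕ} {M : Type*} [MetricSpace M] [CompactSpace M]

theorem le_iSup_continuousMap (f : C(M, ℝ)) (x : M) : f x ≤ ⨆ y, f y :=
  le_ciSup (isCompact_range f.continuous).bddAbove x

theorem iInf_continuousMap_le (f : C(M, ℝ)) (x : M) : ⨅ y, f y ≤ f x :=
  ciInf_le (isCompact_range f.continuous).bddBelow x

theorem osc_nonneg (f : C(M, ℝ)) : 0 ≤ osc f := by
  rcases isEmpty_or_nonempty M with h | ⟨⟨x⟩⟩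
  · simp [osc]
  · exact sub_nonneg.2 ((iInf_continuousMap_le f x).trans (le_iSup_continuousMap f x))

theorem osc_le (f : C(M, ℝ)) : osc f ≤ 2 * ‖f‖ := by
  rcases isEmpty_or_nonempty M with h | h
  · simp [osc]
  · have h1 : ⨆ x, f x ≤ ‖f‖ := ciSup_le fun x => f.apply_le_norm x
    have h2 : -‖f‖ ≤ ⨅ x, f x := le_ciInf fun x => f.neg_norm_le_apply x
    unfold osc
    linarith

theorem osc_neg (f : C(M, ℝ)) : osc (-f) = osc f := by
  rcases isEmpty_or_nonempty M with h | h
  · simp [osc]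
  have h1 : ⨆ x, (-f) x = -⨅ x, f x :=
    (OrderIso.neg ℝ).map_ciInf (isCompact_range f.continuous).bddBelow |>.symm
  have h2 : ⨅ x, (-f) x = -⨆ x, f x :=
    (OrderIso.neg ℝ).map_ciSup (isCompact_range f.continuous).bddAbove |>.symm
  unfold osc
  rw [h1, h2]
  ring

theorem continuous_osc : Continuous (osc : C(M, ℝ) → ℝ) := by
  have h1 : Continuous fun f : C(M, ℝ) => sSup ((fun x => f x) '' Set.univ) :=
    isCompact_univ.continuous_sSup (f := fun (f : C(M, ℝ)) x => f x) continuous_eval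
  have h2 : Continuous fun f : C(M, ℝ) => sInf ((fun x => f x) '' Set.univ) :=
    isCompact_univ.continuous_sInf (f := fun (f : C(M, ℝ)) x => f x) continuous_eval
  simp only [Set.image_univ] at h1 h2
  exact h1.sub h2

variable [ChartedSpace (E n) M] [MeasurableSpace M]

theorem contactNorm_neg (α : OneForm n M) (f : C(M, ℝ)) : contactNorm α (-f) = contactNorm α f := by
  unfold contactNorm
  rw [osc_neg]
  simp [integral_neg]

theorem contactNorm_nonneg (α : OneForm n M) (f : C(M, ℝ)) : 0 ≤ contactNorm α f :=
  add_nonneg (osc_nonneg f) (abs_nonneg _)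

/-- The norm `‖H‖_{(1,∞)} = ∫_0^1 ‖H_t‖ dt` built on the contact norm. -/
def contactL1Norm (α : OneForm n M) (H : L1Infty M) : ℝ := ∫ t, contactNorm α (H t)

theorem contactL1Norm_nonneg (α : OneForm n M) (H : L1Infty M) : 0 ≤ contactL1Norm α H :=
  integral_nonneg fun _ => contactNorm_nonneg _ _

theorem hamDist_eq (α : OneForm n M) (H F : L1Infty M) : hamDist α H F = contactL1Norm α (H - F) := by
  refine integral_congr_ae ?_
  filter_upwards [Lp.coeFn_sub H F] with t h
  rw [h]
  rfl

theorem abs_integral_le (μ : Measure M) [IsFiniteMeasure μ] (f : C(M, ℝ)) :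
    |∫ x, f x ∂μ| ≤ ‖f‖ * μ.real Set.univ :=
  norm_integral_le_of_norm_le_const (Eventually.of_forall f.norm_coe_le_norm)

theorem contactNorm_le (α : OneForm n M) [IsFiniteMeasure (contactVolume α)] (f : C(M, ℝ)) :
    contactNorm α f ≤ (2 + (contactVolume α).real Set.univ) * ‖f‖ := by
  have h1 := osc_le f
  have h2 := abs_integral_le (contactVolume α) f
  unfold contactNorm
  linarith

variable [BorelSpace M]

theorem integrable_continuousMap (μ : Measure M) [IsFiniteMeasure μ] (f : C(M, ℝ)) :
    Integrable f μ :=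
  f.continuous.integrable_of_hasCompactSupport (HasCompactSupport.of_compactSpace f)

theorem continuous_integral_continuousMap (μ : Measure M) [IsFiniteMeasure μ] :
    Continuous fun f : C(M, ℝ) => ∫ x, f x ∂μ := by
  refine (LipschitzWith.of_dist_le_mul (K := (μ Set.univ).toNNReal) fun f g => ?_).continuous
  rw [Real.dist_eq, ← integral_sub (integrable_continuousMap μ f) (integrable_continuousMap μ g),
    dist_eq_norm, mul_comm]
  exact abs_integral_le μ (f - g)

theorem continuous_contactNorm (α : OneForm n M) [IsFiniteMeasure (contactVolume α)] :
    Continuous (contactNorm α) :=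
  continuous_osc.add (continuous_integral_continuousMap _).abs

/-- The sup norm is controlled by the contact norm: the values of `f` differ from its mean, which
is `∫ f` divided by the total volume, by at most `osc f`. -/
theorem norm_le_contactNorm (α : OneForm n M) [IsFiniteMeasure (contactVolume α)]
    (hpos : Nonempty M → contactVolume α ≠ 0) (f : C(M, ℝ)) :
    ‖f‖ ≤ (1 + ((contactVolume α).real Set.univ)⁻¹) * contactNorm α f := by
  have hc := contactNorm_nonneg α f
  refine (ContinuousMap.norm_le _ (by positivity)).2 fun x => ?_
  set V := (contactVolume α).real Set.univ with hV
  have hVpos : 0 < V := by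
    rw [hV, measureReal_def]
    exact ENNReal.toReal_pos (Measure.measure_univ_ne_zero.2 (hpos ⟨x⟩)) (measure_ne_top _ _)
  set I := ∫ x, f x ∂(contactVolume α) with hI
  have hint := integrable_continuousMap (contactVolume α) f
  have h1 : I ≤ V * ⨆ y, f y := by
    have := integral_mono hint (integrable_const _) (le_iSup_continuousMap f)
    simpa [hV] using this
  have h2 : V * ⨅ y, f y ≤ I := by
    have := integral_mono (integrable_const _) hint (iInf_continuousMap_le f)
    simpa [hV] using this
  have h3 := le_iSup_continuousMap f x
  have h4 := iInf_continuousMap_le f x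
  have h5 : I / V ≤ ⨆ y, f y := by rw [div_le_iff₀ hVpos]; linarith
  have h6 : ⨅ y, f y ≤ I / V := by rw [le_div_iff₀ hVpos]; linarith
  have h7 : |f x| ≤ osc f + |I / V| := by
    have := le_abs_self (I / V)
    have := neg_abs_le (I / V)
    unfold osc
    rw [abs_le]
    constructor <;> linarith
  have h8 : |I / V| = V⁻¹ * |I| := by rw [abs_div, abs_of_pos hVpos]; ring
  rw [Real.norm_eq_abs]
  have h9 : contactNorm α f = osc f + |I| := rfl
  have h10 : 0 ≤ V⁻¹ * osc f := mul_nonneg (by positivity) (osc_nonneg f)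
  have h11 := abs_nonneg I
  rw [h9]
  nlinarith

section Integrals

variable (α : OneForm n M) [IsFiniteMeasure (contactVolume α)]

theorem integrable_contactNorm (H : L1Infty M) : Integrable fun t => contactNorm α (H t) := by
  refine Integrable.mono'
    ((memLp_one_iff_integrable.1 (Lp.memLp H)).norm.const_mul
      (2 + (contactVolume α).real Set.univ))
    ((continuous_contactNorm α).comp_aestronglyMeasurable (Lp.aestronglyMeasurable H))
    (Eventually.of_forall fun t => ?_)
  rw [Real.norm_of_nonneg (contactNorm_nonneg _ _)]
  exact contactNorm_le α _

theorem contactL1Norm_le (H : L1Infty M) :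
    contactL1Norm α H ≤ (2 + (contactVolume α).real Set.univ) * ‖H‖ := by
  rw [L1.norm_eq_integral_norm, ← integral_const_mul]
  exact integral_mono (integrable_contactNorm α H)
    ((memLp_one_iff_integrable.1 (Lp.memLp H)).norm.const_mul _) fun t => contactNorm_le α _

theorem norm_le_contactL1Norm (hpos : Nonempty M → contactVolume α ≠ 0) (H : L1Infty M) :
    ‖H‖ ≤ (1 + ((contactVolume α).real Set.univ)⁻¹) * contactL1Norm α H := by
  rw [L1.norm_eq_integral_norm, contactL1Norm, ← integral_const_mul]
  exact integral_mono (memLp_one_iff_integrable.1 (Lp.memLp H)).norm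
    ((integrable_contactNorm α H).const_mul _) fun t => norm_le_contactNorm α hpos _

theorem contactDist_eq (p q : HomeoPath M × L1Infty M) :
    contactDist α p q = dist p.1 q.1 +
      (contactL1Norm α (p.2 - q.2) + contactL1Norm α (compHam p.2 p.1 - compHam q.2 q.1)) := by
  unfold contactDist contactL1Norm
  rw [← integral_add (integrable_contactNorm α _) (integrable_contactNorm α _)]
  congr 1
  refine integral_congr_ae ?_
  filter_upwards [Lp.coeFn_sub p.2 q.2, Lp.coeFn_sub (compHam p.2 p.1) (compHam q.2 q.1),
    coeFn_compHam p.2 p.1, coeFn_compHam q.2 q.1] with t h1 h2 h3 h4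
  rw [h1, h2, Pi.sub_apply, Pi.sub_apply, h3, h4, ← contactNorm_neg α ((p.2 t).comp _ - _)]
  congr 2
  unfold invHam
  abel

theorem tendsto_contactL1Norm_sub (H : L1Infty M) :
    Tendsto (fun F => contactL1Norm α (H - F)) (𝓝 H) (𝓝 0) := by
  refine squeeze_zero (fun _ => contactL1Norm_nonneg α _) (fun F => contactL1Norm_le α (H - F)) ?_
  have hc : Continuous fun F : L1Infty M => (2 + (contactVolume α).real Set.univ) * ‖H - F‖ := by
    fun_prop
  simpa using hc.tendsto H

theorem distTopology_hamDist (hpos : Nonempty M → contactVolume α ≠ 0) :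
    distTopology (hamDist α) = (inferInstance : TopologicalSpace (L1Infty M)) := by
  refine distTopology_eq _ (fun H => ?_) fun H U hU => ?_
  · exact (tendsto_congr fun F => hamDist_eq α H F).2 (tendsto_contactL1Norm_sub α H)
  · obtain ⟨ε, hε, hball⟩ := Metric.mem_nhds_iff.1 hU
    have hK : 0 < 1 + ((contactVolume α).real Set.univ)⁻¹ := by positivity
    refine ⟨ε / (1 + ((contactVolume α).real Set.univ)⁻¹), by positivity, fun F hF => hball ?_⟩
    rw [hamDist_eq, lt_div_iff₀' hK] at hF
    rw [Metric.mem_ball, dist_comm, dist_eq_norm]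
    exact (norm_le_contactL1Norm α hpos _).trans_lt hF

theorem pairTopology_eq (hpos : Nonempty M → contactVolume α ≠ 0) :
    pairTopology α = (inferInstance : TopologicalSpace (HomeoPath M × L1Infty M)) := by
  unfold pairTopology
  rw [distTopology_hamDist α hpos]

/-- On any set of pairs the contact distance induces the product topology: the extra term
`∫ ‖H_t ∘ φ_t - F_t ∘ ψ_t‖ dt` is continuous, since composition is. -/
theorem distTopology_contactDist (hpos : Nonempty M → contactVolume α ≠ 0)
    (S : Set (HomeoPath M × L1Infty M)) :
    distTopology (fun p q : S => contactDist α p.1 q.1) =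
      (inferInstance : TopologicalSpace S) := by
  refine distTopology_eq _ (fun p => ?_) fun p U hU => ?_
  · simp only [contactDist_eq]
    have h1 : Tendsto (fun q : S => dist p.1.1 q.1.1) (𝓝 p) (𝓝 0) := by
      have hc : Continuous fun q : S => dist p.1.1 q.1.1 := by fun_prop
      simpa using hc.tendsto p
    have h2 : Tendsto (fun q : S => contactL1Norm α (p.1.2 - q.1.2)) (𝓝 p) (𝓝 0) :=
      (tendsto_contactL1Norm_sub α p.1.2).comp
        ((continuous_snd.comp continuous_subtype_val).tendsto p)
    have h3 : Tendsto (fun q : S => contactL1Norm α (compHam p.1.2 p.1.1 - compHam q.1.2 q.1.1))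
        (𝓝 p) (𝓝 0) := by
      have hc : Continuous fun q : S => compHam q.1.2 q.1.1 :=
        continuous_compHam.comp
          ((continuous_snd.comp continuous_subtype_val).prodMk
            (continuous_fst.comp continuous_subtype_val))
      exact (tendsto_contactL1Norm_sub α (compHam p.1.2 p.1.1)).comp (hc.tendsto p)
    simpa using h1.add (h2.add h3)
  · obtain ⟨ε, hε, hball⟩ := Metric.mem_nhds_iff.1 hU
    have hK : 0 < 1 + ((contactVolume α).real Set.univ)⁻¹ := by positivity
    refine ⟨min ε (ε / (1 + ((contactVolume α).real Set.univ)⁻¹)), by positivity,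
      fun q hq => hball ?_⟩
    rw [contactDist_eq] at hq
    have h1 := contactL1Norm_nonneg α (p.1.2 - q.1.2)
    have h2 := contactL1Norm_nonneg α (compHam p.1.2 p.1.1 - compHam q.1.2 q.1.1)
    have h3 : 0 ≤ dist p.1.1 q.1.1 := dist_nonneg
    have h4 := hq.trans_le (min_le_left _ _)
    have h5 : contactL1Norm α (p.1.2 - q.1.2) < ε / (1 + ((contactVolume α).real Set.univ)⁻¹) := by
      linarith [hq.trans_le (min_le_right _ _)]
    rw [lt_div_iff₀' hK] at h5
    rw [Metric.mem_ball, dist_comm, Subtype.dist_eq, Prod.dist_eq, max_lt_iff]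
    refine ⟨by linarith, ?_⟩
    rw [dist_eq_norm]
    exact (norm_le_contactL1Norm α hpos _).trans_lt h5

end Integrals
end Norms

/-! ### One-forms and the volume density under a change of charts -/

open Set

section TopForm

variable {n : ℕ} {V : Type*} [AddCommGroup V] [Module ℝ V]

/-- Changing the argument `j ≠ 0` changes a single factor of the product over the consecutive pairs
`(1, 2), (3, 4), …`. -/
theorem prod_update_pairs {B : Type*} (w : Fin (2 * n + 1) → B) (f : B → B → ℝ)
    (i₀ : Fin n) (j : Fin (2 * n + 1)) (hj : (j : ℕ) = 2 * i₀ + 1 ∨ (j : ℕ) = 2 * i₀ + 2) (x : B) :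
    ∏ i : Fin n, f (Function.update w j x ⟨2 * (i : ℕ) + 1, by omega⟩)
        (Function.update w j x ⟨2 * (i : ℕ) + 2, by omega⟩) =
      f (Function.update w j x ⟨2 * (i₀ : ℕ) + 1, by omega⟩)
        (Function.update w j x ⟨2 * (i₀ : ℕ) + 2, by omega⟩) *
      ∏ i ∈ Finset.univ.erase i₀, f (w ⟨2 * (i : ℕ) + 1, by omega⟩)
        (w ⟨2 * (i : ℕ) + 2, by omega⟩) := by
  rw [← Finset.mul_prod_erase Finset.univ _ (Finset.mem_univ i₀)]
  congr 1
  refine Finset.prod_congr rfl fun i hi => ?_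
  have hne : (i : ℕ) ≠ i₀ := fun h => (Finset.mem_erase.1 hi).1 (Fin.ext h)
  rw [Function.update_of_ne, Function.update_of_ne]
  · intro h
    have := congrArg Fin.val h
    simp only at this
    omega
  · intro h
    have := congrArg Fin.val h
    simp only at this
    omega

/-- The form `a ⊗ β ⊗ ⋯ ⊗ β`, whose alternatization is `2^n a ∧ β^n` for alternating `β`. -/
def pairProduct (n : ℕ) (a : V →ₗ[ℝ] ℝ) (β : V →ₗ[ℝ] V →ₗ[ℝ] ℝ) :
    MultilinearMap ℝ (fun _ : Fin (2 * n + 1) => V) ℝ :=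
  MultilinearMap.mk' (fun w => a (w 0) * ∏ i : Fin n,
      β (w ⟨2 * (i : ℕ) + 1, by omega⟩) (w ⟨2 * (i : ℕ) + 2, by omega⟩))
    (by
      intro w j x y
      rcases Nat.eq_zero_or_pos (j : ℕ) with h0 | hpos
      · obtain rfl : j = 0 := Fin.ext h0
        have hne : ∀ (k : ℕ) (hk : k + 1 < 2 * n + 1), (⟨k + 1, hk⟩ : Fin (2 * n + 1)) ≠ 0 :=
          fun k hk h => by simpa using congrArg Fin.val h
        have h1 : ∀ (z : V) (i : Fin n), Function.update w 0 z ⟨2 * (i : ℕ) + 1, by omega⟩ =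
            w ⟨2 * (i : ℕ) + 1, by omega⟩ := fun z i => Function.update_of_ne (hne _ _) _ _
        have h2 : ∀ (z : V) (i : Fin n), Function.update w 0 z ⟨2 * (i : ℕ) + 2, by omega⟩ =
            w ⟨2 * (i : ℕ) + 2, by omega⟩ := fun z i => Function.update_of_ne (hne _ _) _ _
        simp only [h1, h2, Function.update_self, map_add, add_mul]
      · obtain ⟨i₀, hi₀⟩ : ∃ i₀ : Fin n, (j : ℕ) = 2 * i₀ + 1 ∨ (j : ℕ) = 2 * i₀ + 2 :=
          ⟨⟨((j : ℕ) - 1) / 2, by omega⟩, by simp only; omega⟩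
        have hj0 : (0 : Fin (2 * n + 1)) ≠ j := fun h => by simp [← h] at hpos
        simp only [prod_update_pairs w (fun u v => β u v) i₀ j hi₀, Function.update_of_ne hj0]
        rw [← mul_add, ← add_mul]
        congr 2
        rcases hi₀ with h | h
        · have heq : (⟨2 * (i₀ : ℕ) + 1, by omega⟩ : Fin (2 * n + 1)) = j := Fin.ext h.symm
          have hne : (⟨2 * (i₀ : ℕ) + 2, by omega⟩ : Fin (2 * n + 1)) ≠ j :=
            fun h' => by simpa [h] using congrArg Fin.val h'
          simp only [heq, Function.update_self, Function.update_of_ne hne, map_add, LinearMap.add_apply]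
        · have heq : (⟨2 * (i₀ : ℕ) + 2, by omega⟩ : Fin (2 * n + 1)) = j := Fin.ext h.symm
          have hne : (⟨2 * (i₀ : ℕ) + 1, by omega⟩ : Fin (2 * n + 1)) ≠ j :=
            fun h' => by simpa [h] using congrArg Fin.val h'
          simp only [heq, Function.update_self, Function.update_of_ne hne, map_add])
    (by
      intro w j c x
      rcases Nat.eq_zero_or_pos (j : ℕ) with h0 | hpos
      · obtain rfl : j = 0 := Fin.ext h0
        have hne : ∀ (k : ℕ) (hk : k + 1 < 2 * n + 1), (⟨k + 1, hk⟩ : Fin (2 * n + 1)) ≠ 0 :=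
          fun k hk h => by simpa using congrArg Fin.val h
        have h1 : ∀ (z : V) (i : Fin n), Function.update w 0 z ⟨2 * (i : ℕ) + 1, by omega⟩ =
            w ⟨2 * (i : ℕ) + 1, by omega⟩ := fun z i => Function.update_of_ne (hne _ _) _ _
        have h2 : ∀ (z : V) (i : Fin n), Function.update w 0 z ⟨2 * (i : ℕ) + 2, by omega⟩ =
            w ⟨2 * (i : ℕ) + 2, by omega⟩ := fun z i => Function.update_of_ne (hne _ _) _ _
        simp only [h1, h2, Function.update_self, map_smul, smul_eq_mul, mul_assoc]
      · obtain ⟨i₀, hi₀⟩ : ∃ i₀ : Fin n, (j : ℕ) = 2 * i₀ + 1 ∨ (j : ℕ) = 2 * i₀ + 2 :=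
          ⟨⟨((j : ℕ) - 1) / 2, by omega⟩, by simp only; omega⟩
        have hj0 : (0 : Fin (2 * n + 1)) ≠ j := fun h => by simp [← h] at hpos
        simp only [prod_update_pairs w (fun u v => β u v) i₀ j hi₀, Function.update_of_ne hj0]
        rw [smul_eq_mul, mul_left_comm c, ← mul_assoc c]
        congr 2
        rcases hi₀ with h | h
        · have heq : (⟨2 * (i₀ : ℕ) + 1, by omega⟩ : Fin (2 * n + 1)) = j := Fin.ext h.symm
          have hne : (⟨2 * (i₀ : ℕ) + 2, by omega⟩ : Fin (2 * n + 1)) ≠ j :=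
            fun h' => by simpa [h] using congrArg Fin.val h'
          simp only [heq, Function.update_self, Function.update_of_ne hne, map_smul,
            LinearMap.smul_apply, smul_eq_mul]
        · have heq : (⟨2 * (i₀ : ℕ) + 2, by omega⟩ : Fin (2 * n + 1)) = j := Fin.ext h.symm
          have hne : (⟨2 * (i₀ : ℕ) + 1, by omega⟩ : Fin (2 * n + 1)) ≠ j :=
            fun h' => by simpa [h] using congrArg Fin.val h'
          simp only [heq, Function.update_self, Function.update_of_ne hne, map_smul, smul_eq_mul])

theorem pairProduct_apply (a : V →ₗ[ℝ] ℝ) (β : V →ₗ[ℝ] V →ₗ[ℝ] ℝ) (w : Fin (2 * n + 1) → V) :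
    pairProduct n a β w = a (w 0) * ∏ i : Fin n,
      β (w ⟨2 * (i : ℕ) + 1, by omega⟩) (w ⟨2 * (i : ℕ) + 2, by omega⟩) := rfl

/-- A top-degree form pulled back by a linear map is multiplied by the determinant. -/
theorem alternatization_pairProduct_comp (b : Module.Basis (Fin (2 * n + 1)) ℝ V)
    (a : V →ₗ[ℝ] ℝ) (β : V →ₗ[ℝ] V →ₗ[ℝ] ℝ) (L : V →ₗ[ℝ] V) :
    MultilinearMap.alternatization (pairProduct n (a ∘ₗ L) (β.compl₁₂ L L)) b =
      LinearMap.det L * MultilinearMap.alternatization (pairProduct n a β) b := by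
  have h : MultilinearMap.alternatization (pairProduct n (a ∘ₗ L) (β.compl₁₂ L L)) b =
      MultilinearMap.alternatization (pairProduct n a β) (L ∘ b) := by
    simp only [MultilinearMap.alternatization_apply, MultilinearMap.domDomCongr_apply,
      pairProduct_apply, LinearMap.comp_apply, LinearMap.compl₁₂_apply, Function.comp_apply]
  rw [h, AlternatingMap.eq_smul_basis_det b (MultilinearMap.alternatization (pairProduct n a β)),
    AlternatingMap.smul_apply, AlternatingMap.smul_apply, Module.Basis.det_comp,
    Module.Basis.det_self]
  simp only [smul_eq_mul, mul_one]
  ring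

end TopForm

section Charts

theorem transition_source_subset {X Y Z : Type*} [TopologicalSpace X]
    [TopologicalSpace Y] [TopologicalSpace Z] {e : OpenPartialHomeomorph X Y}
    {e' : OpenPartialHomeomorph X Z} {y : Y}
    (hy : y ∈ (e.symm.trans e').source) : y ∈ e.target ∧ e.symm y ∈ e'.source := by
  rw [OpenPartialHomeomorph.trans_source] at hy
  exact hy

variable {n : ℕ} {M : Type*} [TopologicalSpace M] [ChartedSpace (E n) M]

/-- The bilinear form `dα` in a chart at a point. -/
def OneForm.dBilin (α : OneForm n M) (e : OpenPartialHomeomorph M (E n)) (y : E n) :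
    E n →ₗ[ℝ] E n →ₗ[ℝ] ℝ :=
  LinearMap.mk₂ ℝ (α.dInChart e y)
    (fun u u' v => by simp [OneForm.dInChart]; ring)
    (fun c u v => by simp [OneForm.dInChart]; ring)
    (fun u v v' => by simp [OneForm.dInChart]; ring)
    (fun c u v => by simp [OneForm.dInChart]; ring)

theorem volInChart_eq (α : OneForm n M) (e : OpenPartialHomeomorph M (E n)) (y : E n) :
    α.volInChart e y = (1 / 2 ^ n : ℝ) * MultilinearMap.alternatization
      (pairProduct n (α.inChart e y : E n →ₗ[ℝ] ℝ) (α.dBilin e y))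
        (EuclideanSpace.basisFun (Fin (2 * n + 1)) ℝ).toBasis := by
  rw [MultilinearMap.alternatization_apply]
  unfold OneForm.volInChart
  congr 1
  refine Finset.sum_congr rfl fun σ _ => ?_
  rw [MultilinearMap.domDomCongr_apply, pairProduct_apply]
  simp only [OrthonormalBasis.coe_toBasis, EuclideanSpace.basisFun_apply, Units.smul_def,
    zsmul_eq_mul]
  rfl

theorem two_le_infty : (1 + 1 : WithTop ℕ∞) ≤ ∞ := by
  have h : ((2 : ℕ∞) : WithTop ℕ∞) ≤ ((⊤ : ℕ∞) : WithTop ℕ∞) := WithTop.coe_le_coe.2 le_top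
  rwa [one_add_one_eq_two]

theorem contDiffOn_transition {e e' : OpenPartialHomeomorph M (E n)}
    (he : e ∈ IsManifold.maximalAtlas 𝓘(ℝ, E n) ∞ M)
    (he' : e' ∈ IsManifold.maximalAtlas 𝓘(ℝ, E n) ∞ M) :
    ContDiffOn ℝ ∞ (e' ∘ e.symm) (e.symm.trans e').source := by
  rw [← contMDiffOn_iff_contDiffOn]
  have h := contMDiffOn_of_mem_maximalAtlas he'
  have h' := contMDiffOn_symm_of_mem_maximalAtlas he
  refine h.comp (h'.mono fun y hy => ?_) fun y hy => ?_
  · exact (transition_source_subset hy).1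
  · exact (transition_source_subset hy).2

theorem mdifferentiableAt_chart_symm {e : OpenPartialHomeomorph M (E n)}
    (he : e ∈ IsManifold.maximalAtlas 𝓘(ℝ, E n) ∞ M) {y : E n} (hy : y ∈ e.target) :
    MDifferentiableAt 𝓘(ℝ, E n) 𝓘(ℝ, E n) e.symm y :=
  ((contMDiffOn_symm_of_mem_maximalAtlas he).contMDiffAt
    (e.open_target.mem_nhds hy)).mdifferentiableAt (by simp)

theorem mdifferentiableAt_chart {e : OpenPartialHomeomorph M (E n)}
    (he : e ∈ IsManifold.maximalAtlas 𝓘(ℝ, E n) ∞ M) {x : M} (hx : x ∈ e.source) :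
    MDifferentiableAt 𝓘(ℝ, E n) 𝓘(ℝ, E n) e x :=
  (contMDiffAt_of_mem_maximalAtlas he hx).mdifferentiableAt (by simp)

/-- Tangent spaces at propositionally equal points are only identified through the model space, so
equalities of base points are transported by this lemma rather than by rewriting. -/
theorem oneForm_congr (α : OneForm n M) {x x' : M} (h : x = x') (v : E n) :
    (α x : E n →L[ℝ] ℝ) v = (α x' : E n →L[ℝ] ℝ) v := by
  rw [h]

/-- If `g = e.symm ∘ f` near `y` then `α(g y) ∘ Dg(y)` is the pull-back by `f` of the expression of
`α` in the chart `e`. -/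
theorem inChart_comp {N : Type*} [TopologicalSpace N] [ChartedSpace (E n) N] (α : OneForm n M)
    {e : OpenPartialHomeomorph M (E n)} (he : e ∈ IsManifold.maximalAtlas 𝓘(ℝ, E n) ∞ M)
    {f : N → E n} {g : N → M} {y : N} (hfy : f y ∈ e.target)
    (hf : MDifferentiableAt 𝓘(ℝ, E n) 𝓘(ℝ, E n) f y) (hg : g =ᶠ[𝓝 y] e.symm ∘ f) :
    (α (g y)).comp (mfderiv 𝓘(ℝ, E n) 𝓘(ℝ, E n) g y) =
      (α.inChart e (f y)).comp (mfderiv 𝓘(ℝ, E n) 𝓘(ℝ, E n) f y) := by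
  rw [hg.mfderiv_eq, mfderiv_comp y (mdifferentiableAt_chart_symm he hfy) hf]
  ext v
  exact oneForm_congr α hg.eq_of_nhds _

theorem inChart_transition (α : OneForm n M) {e e' : OpenPartialHomeomorph M (E n)}
    (he : e ∈ IsManifold.maximalAtlas 𝓘(ℝ, E n) ∞ M)
    (he' : e' ∈ IsManifold.maximalAtlas 𝓘(ℝ, E n) ∞ M) {y : E n}
    (hy : y ∈ (e.symm.trans e').source) :
    α.inChart e y =
      (α.inChart e' ((e' ∘ e.symm) y)).comp (fderiv ℝ (e' ∘ e.symm) y) := by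
  have hopen := (e.symm.trans e').open_source
  have hd : DifferentiableAt ℝ (e' ∘ e.symm) y :=
    ((contDiffOn_transition he he').contDiffAt (hopen.mem_nhds hy)).differentiableAt (by simp)
  have h := inChart_comp α he' (g := e.symm) (e'.map_source (transition_source_subset hy).2)
    hd.mdifferentiableAt (by
      filter_upwards [hopen.mem_nhds hy] with z hz
      exact (e'.left_inv (transition_source_subset hz).2).symm)
  rwa [mfderiv_eq_fderiv] at h

/-- The exterior derivative commutes with changes of charts, by the symmetry of second derivatives. -/
theorem dInChart_transition (α : OneForm n M) (hα : α.IsSmooth)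
    {e e' : OpenPartialHomeomorph M (E n)}
    (he : e ∈ IsManifold.maximalAtlas 𝓘(ℝ, E n) ∞ M)
    (he' : e' ∈ IsManifold.maximalAtlas 𝓘(ℝ, E n) ∞ M) {y : E n}
    (hy : y ∈ (e.symm.trans e').source) (u v : E n) :
    α.dInChart e y u v = α.dInChart e' ((e' ∘ e.symm) y)
      (fderiv ℝ (e' ∘ e.symm) y u) (fderiv ℝ (e' ∘ e.symm) y v) := by
  set τ := e' ∘ e.symm with hτ
  have hopen := (e.symm.trans e').open_source
  have hτ_smooth : ContDiffAt ℝ ∞ τ y :=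
    (contDiffOn_transition he he').contDiffAt (hopen.mem_nhds hy)
  have hmem : τ y ∈ e'.target := e'.map_source (transition_source_subset hy).2
  have ha : DifferentiableAt ℝ (α.inChart e') (τ y) :=
    ((hα e' he').contDiffAt (e'.open_target.mem_nhds hmem)).differentiableAt (by simp)
  have hτd : DifferentiableAt ℝ τ y := hτ_smooth.differentiableAt (by simp)
  have hτdd : DifferentiableAt ℝ (fderiv ℝ τ) y :=
    (hτ_smooth.fderiv_right (m := 1) two_le_infty).differentiableAt (by simp)
  have hsymm : IsSymmSndFDerivAt ℝ τ y := hτ_smooth.isSymmSndFDerivAt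
    (by simpa [one_add_one_eq_two] using two_le_infty)
  have heq : α.inChart e =ᶠ[𝓝 y] fun z => (α.inChart e' (τ z)).comp (fderiv ℝ τ z) := by
    filter_upwards [hopen.mem_nhds hy] with z hz using inChart_transition α he he' hz
  have hder := (ha.hasFDerivAt.comp y hτd.hasFDerivAt).clm_comp hτdd.hasFDerivAt
  have hfd : ∀ p q : E n, fderiv ℝ (α.inChart e) y p q =
      α.inChart e' (τ y) (fderiv ℝ (fderiv ℝ τ) y p q) +
        fderiv ℝ (α.inChart e') (τ y) (fderiv ℝ τ y p) (fderiv ℝ τ y q) := by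
    intro p q
    rw [heq.fderiv_eq, show (fun z => (α.inChart e' (τ z)).comp (fderiv ℝ τ z)) =
      fun z => ((α.inChart e' ∘ τ) z).comp (fderiv ℝ τ z) from rfl, hder.fderiv]
    simp
  unfold OneForm.dInChart
  rw [hfd, hfd, hsymm.eq u v]
  ring

/-- Under a change of charts the density of the volume form is multiplied by the Jacobian. -/
theorem volInChart_transition (α : OneForm n M) (hα : α.IsSmooth)
    {e e' : OpenPartialHomeomorph M (E n)}
    (he : e ∈ IsManifold.maximalAtlas 𝓘(ℝ, E n) ∞ M)
    (he' : e' ∈ IsManifold.maximalAtlas 𝓘(ℝ, E n) ∞ M) {y : E n}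
    (hy : y ∈ (e.symm.trans e').source) :
    α.volInChart e y =
      (fderiv ℝ (e' ∘ e.symm) y).det * α.volInChart e' ((e' ∘ e.symm) y) := by
  rw [volInChart_eq, volInChart_eq]
  have h1 : (α.inChart e y : E n →ₗ[ℝ] ℝ) =
      (α.inChart e' ((e' ∘ e.symm) y) : E n →ₗ[ℝ] ℝ) ∘ₗ
        (fderiv ℝ (e' ∘ e.symm) y : E n →ₗ[ℝ] E n) := by
    rw [inChart_transition α he he' hy]
    rfl
  have h2 : α.dBilin e y = (α.dBilin e' ((e' ∘ e.symm) y)).compl₁₂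
      (fderiv ℝ (e' ∘ e.symm) y : E n →ₗ[ℝ] E n) (fderiv ℝ (e' ∘ e.symm) y : E n →ₗ[ℝ] E n) := by
    ext u v
    exact dInChart_transition α hα he he' hy u v
  rw [h1, h2, alternatization_pairProduct_comp]
  change _ * (LinearMap.det _ * _) = LinearMap.det _ * _
  ring

end Charts

/-! ### The contact volume is finite and nonzero -/

section Volume

theorem measurableSet_target_inter_preimage {X Y : Type*} [TopologicalSpace X]
    [MeasurableSpace X] [BorelSpace X] [TopologicalSpace Y] [MeasurableSpace Y] [BorelSpace Y]
    (e : OpenPartialHomeomorph X Y) {A : Set X}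
   
    (hA : MeasurableSet A) : MeasurableSet (e.target ∩ e.symm ⁻¹' A) := by
  have h : Measurable (e.target.domRestrict e.symm) :=
    (continuousOn_iff_continuous_domRestrict.1 e.continuousOn_symm).measurable
  have h' := e.open_target.measurableSet.subtype_image (h hA)
  have heq : Subtype.val '' (e.target.domRestrict e.symm ⁻¹' A) = e.target ∩ e.symm ⁻¹' A :=
    Subtype.image_preimage_coe e.target (e.symm ⁻¹' A)
  rwa [heq] at h'

variable {n : ℕ} {M : Type*} [TopologicalSpace M] [ChartedSpace (E n) M]

theorem continuousOn_volInChart {α : OneForm n M} (hα : α.IsSmooth)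
    {e : OpenPartialHomeomorph M (E n)} (he : e ∈ IsManifold.maximalAtlas 𝓘(ℝ, E n) ∞ M) :
    ContinuousOn (α.volInChart e) e.target := by
  have h0 := (hα e he).continuousOn
  have h1 := (hα e he).continuousOn_fderiv_of_isOpen e.open_target (by simp)
  have hd : ∀ u v : E n, ContinuousOn (fun y => α.dInChart e y u v) e.target := fun u v =>
    ((h1.clm_apply continuousOn_const).clm_apply continuousOn_const).sub
      ((h1.clm_apply continuousOn_const).clm_apply continuousOn_const)
  unfold OneForm.volInChart
  exact continuousOn_const.mul (continuousOn_finsetSum _ fun σ _ => continuousOn_const.mul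
    ((h0.clm_apply continuousOn_const).mul (continuousOn_finsetProd _ fun i _ => hd _ _)))

variable [MeasurableSpace M]

/-- The part of the contact volume seen by a single chart. -/
def chartVolume (α : OneForm n M) (e : OpenPartialHomeomorph M (E n)) : Measure M :=
  (((volume : Measure (E n)).restrict e.target).withDensity
    (fun y => ENNReal.ofReal |α.volInChart e y|)).map e.symm

theorem chartVolume_le_contactVolume (α : OneForm n M) {e : OpenPartialHomeomorph M (E n)}
    (he : e ∈ IsManifold.maximalAtlas 𝓘(ℝ, E n) ∞ M) : chartVolume α e ≤ contactVolume α :=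
  le_iSup₂_of_le e he le_rfl

variable [BorelSpace M]

theorem chartVolume_apply (α : OneForm n M) (e : OpenPartialHomeomorph M (E n)) {A : Set M}
    (hA : MeasurableSet A) : chartVolume α e A =
      ∫⁻ y in e.target ∩ e.symm ⁻¹' A, ENNReal.ofReal |α.volInChart e y| := by
  have hm : AEMeasurable e.symm (((volume : Measure (E n)).restrict e.target).withDensity
      (fun y => ENNReal.ofReal |α.volInChart e y|)) :=
    (e.continuousOn_symm.aemeasurable e.open_target.measurableSet).mono_ac
      (withDensity_absolutelyContinuous _ _)
  rw [chartVolume, Measure.map_apply_of_aemeasurable hm hA, withDensity_apply',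
    Measure.restrict_restrict' e.open_target.measurableSet, inter_comm]

/-- By the change of variables formula the chart measures agree on overlaps; the inequality
suffices to compare them with the least upper bound. -/
theorem chartVolume_le_chartVolume {α : OneForm n M} (hα : α.IsSmooth)
    {e e' : OpenPartialHomeomorph M (E n)}
    (he : e ∈ IsManifold.maximalAtlas 𝓘(ℝ, E n) ∞ M)
    (he' : e' ∈ IsManifold.maximalAtlas 𝓘(ℝ, E n) ∞ M) {A : Set M}
    (hA : MeasurableSet A) (hA' : A ⊆ e'.source) : chartVolume α e A ≤ chartVolume α e' A := by
  rw [chartVolume_apply α e hA, chartVolume_apply α e' hA]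
  set B := e.target ∩ e.symm ⁻¹' A with hB
  have hBm : MeasurableSet B := measurableSet_target_inter_preimage e hA
  have hBS : B ⊆ (e.symm.trans e').source := fun y hy => by
    rw [OpenPartialHomeomorph.trans_source]
    exact ⟨hy.1, hA' hy.2⟩
  have hopen := (e.symm.trans e').open_source
  have hder : ∀ y ∈ B, HasFDerivWithinAt (e' ∘ e.symm) (fderiv ℝ (e' ∘ e.symm) y) B y :=
    fun y hy => (((contDiffOn_transition he he').contDiffAt
      (hopen.mem_nhds (hBS hy))).differentiableAt (by simp)).hasFDerivAt.hasFDerivWithinAt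
  have hinj : InjOn (e' ∘ e.symm) B := fun y hy z hz h =>
    (e.symm.trans e').injOn (hBS hy) (hBS hz) h
  have himg : (e' ∘ e.symm) '' B ⊆ e'.target ∩ e'.symm ⁻¹' A := by
    rintro _ ⟨y, hy, rfl⟩
    refine ⟨e'.map_source (hA' hy.2), ?_⟩
    simpa [e'.left_inv (hA' hy.2)] using hy.2
  refine le_trans (le_of_eq ?_) (lintegral_mono_set himg)
  rw [lintegral_image_eq_lintegral_abs_det_fderiv_mul volume hBm hder hinj]
  refine setLIntegral_congr_fun hBm fun y hy => ?_
  rw [volInChart_transition α hα he he' (hBS hy), abs_mul, ENNReal.ofReal_mul (abs_nonneg _)]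

/-- On the source of a chart the supremum of all chart measures is the measure of that chart; the
term `⊤` makes the bound trivial outside. -/
theorem contactVolume_le {α : OneForm n M} (hα : α.IsSmooth)
    {e : OpenPartialHomeomorph M (E n)} (he : e ∈ IsManifold.maximalAtlas 𝓘(ℝ, E n) ∞ M) :
    contactVolume α ≤ chartVolume α e + (⊤ : Measure M).restrict e.sourceᶜ := by
  have hms : MeasurableSet e.source := e.open_source.measurableSet
  refine iSup₂_le fun e₁ he₁ => ?_
  change chartVolume α e₁ ≤ _
  rw [← Measure.restrict_add_restrict_compl (μ := chartVolume α e₁) hms]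
  refine add_le_add (Measure.le_iff.2 fun A hA => ?_) (Measure.restrict_mono subset_rfl le_top)
  rw [Measure.restrict_apply hA]
  exact (chartVolume_le_chartVolume hα he₁ he (hA.inter hms) inter_subset_right).trans
    (measure_mono inter_subset_left)

variable [IsManifold 𝓘(ℝ, E n) ∞ M]

theorem contactVolume_finiteAt {α : OneForm n M} (hα : α.IsSmooth) (x : M) :
    ∃ U ∈ 𝓝 x, contactVolume α U < ⊤ := by
  set e := chartAt (E n) x with he_def
  have he : e ∈ IsManifold.maximalAtlas 𝓘(ℝ, E n) ∞ M := IsManifold.chart_mem_maximalAtlas x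
  have hx : x ∈ e.source := mem_chart_source (E n) x
  obtain ⟨r, hr, hball⟩ := Metric.nhds_basis_closedBall.mem_iff.1
    (e.open_target.mem_nhds (e.map_source hx))
  set U := e.source ∩ e ⁻¹' Metric.ball (e x) r with hU
  have hUopen : IsOpen U := e.isOpen_inter_preimage Metric.isOpen_ball
  refine ⟨U, hUopen.mem_nhds ⟨hx, Metric.mem_ball_self hr⟩, ?_⟩
  refine ((contactVolume_le hα he) U).trans_lt ?_
  have h0 : (⊤ : Measure M).restrict e.sourceᶜ U = 0 := by
    rw [Measure.restrict_apply hUopen.measurableSet,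
      show U ∩ e.sourceᶜ = ∅ from by ext y; simp [hU]; tauto, measure_empty]
  rw [Measure.add_apply, h0, add_zero, chartVolume_apply α e hUopen.measurableSet]
  have hsub : e.target ∩ e.symm ⁻¹' U ⊆ Metric.closedBall (e x) r := by
    rintro y ⟨hy, hyU⟩
    have := hyU.2
    rw [mem_preimage, e.right_inv hy] at this
    exact Metric.ball_subset_closedBall this
  refine (lintegral_mono_set hsub).trans_lt ?_
  have hint : IntegrableOn (α.volInChart e) (Metric.closedBall (e x) r) :=
    ((continuousOn_volInChart hα he).mono hball).integrableOn_compact (isCompact_closedBall _ _)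
  simpa only [HasFiniteIntegral, Real.enorm_eq_ofReal_abs] using hint.2

theorem isFiniteMeasure_contactVolume [CompactSpace M] {α : OneForm n M} (hα : α.IsSmooth) :
    IsFiniteMeasure (contactVolume α) where
  measure_univ_lt_top := isCompact_univ.measure_lt_top_of_nhdsWithin fun x _ => by
    obtain ⟨U, hU, hlt⟩ := contactVolume_finiteAt hα x
    exact ⟨U, mem_nhdsWithin_of_mem_nhds hU, hlt⟩

theorem contactVolume_ne_zero {α : OneForm n M} (hα : IsContactForm α) (hM : Nonempty M) :
    contactVolume α ≠ 0 := by
  obtain ⟨x⟩ := hM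
  set e := chartAt (E n) x with he_def
  have he : e ∈ IsManifold.maximalAtlas 𝓘(ℝ, E n) ∞ M := IsManifold.chart_mem_maximalAtlas x
  intro h
  have h0 : chartVolume α e univ = 0 := by
    have := chartVolume_le_contactVolume α he univ
    rw [h] at this
    simpa using this
  rw [chartVolume_apply α e MeasurableSet.univ, preimage_univ, inter_univ,
    lintegral_eq_zero_iff'] at h0
  · have h1 : ∀ᵐ y ∂((volume : Measure (E n)).restrict e.target), False := by
      filter_upwards [h0, ae_restrict_mem e.open_target.measurableSet] with y hy hyt
      exact hα.nondegenerate e he y hyt (by simpa using hy)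
    have h2 : (volume : Measure (E n)) e.target = 0 := by
      rw [← Measure.restrict_eq_zero, ← ae_eq_bot]
      simpa using h1
    exact (e.open_target.measure_pos volume ⟨e x, e.map_source (mem_chart_source _ x)⟩).ne' h2
  · exact ((continuousOn_volInChart hα.smooth he).abs.aemeasurable
      e.open_target.measurableSet).ennreal_ofReal

end Volume

/-! ### Smoothness of composed and inverted isotopies -/

section InverseSmooth

variable {X Y : Type*} [NormedAddCommGroup X] [NormedSpace ℝ X] [CompleteSpace X]
  [NormedAddCommGroup Y] [NormedSpace ℝ Y]

/-- A continuous right inverse of a smooth map with invertible derivative is smooth. The domains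
need not be open, which matters for `M × [0,1]`. -/
theorem contDiffOn_rightInverse {f : X → Y} {g : Y → X} {s : Set X} {t : Set Y}
    (hf : ContDiffOn ℝ ∞ f s) (hs : UniqueDiffOn ℝ s) (ht : UniqueDiffOn ℝ t)
    (hg : ContinuousOn g t) (hgm : MapsTo g t s) (hfg : ∀ y ∈ t, f (g y) = y)
    (hinv : ∀ y ∈ t, (fderivWithin ℝ f s (g y)).IsInvertible) : ContDiffOn ℝ ∞ g t := by
  refine contDiffOn_infty.2 fun k => ?_
  induction k with
  | zero => exact contDiffOn_zero.2 hg
  | succ k ih =>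
    push_cast
    rw [contDiffOn_succ_iff_hasFDerivWithinAt_of_uniqueDiffOn ht]
    refine ⟨fun h => absurd h (by simp),
      fun y => (fderivWithin ℝ f s (g y)).inverse, fun y hy => ?_, fun y hy => ?_⟩
    · have h1 : ContDiffWithinAt ℝ k (fun y => fderivWithin ℝ f s (g y)) t y :=
        ((hf.fderivWithin hs (m := k) (by exact_mod_cast le_top)).comp ih hgm) y hy
      exact (hinv y hy).contDiffAt_map_inverse.comp_contDiffWithinAt y h1
    · obtain ⟨L, hL⟩ := hinv y hy
      have hd := (hf.differentiableOn (by simp) (g y) (hgm hy)).hasFDerivWithinAt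
      rw [← hL] at hd
      simp only [← hL, ContinuousLinearMap.inverse_equiv]
      exact hd.of_local_left_inverse
        ((hg y hy).tendsto_nhdsWithin hgm) hy
        (eventually_mem_nhdsWithin.mono hfg)

end InverseSmooth

section LocalRepresentative

variable {n : ℕ} {M : Type*} [MetricSpace M] [CompactSpace M]

theorem contMDiffOn_prod_iff_contDiffOn {F : Type*} [NormedAddCommGroup F] [NormedSpace ℝ F]
    {f : E n × ℝ → F} {s : Set (E n × ℝ)} :
    ContMDiffOn (𝓘(ℝ, E n).prod 𝓘(ℝ, ℝ)) 𝓘(ℝ, F) ∞ f s ↔ ContDiffOn ℝ ∞ f s := by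
  rw [← modelWithCornersSelf_prod, chartedSpaceSelf_prod, contMDiffOn_iff_contDiffOn]

/-- The map `(x, s) ↦ φ_s x` on `M × ℝ`, constant in time outside `[0,1]`. -/
def evalPath (φ : HomeoPath M) (p : M × ℝ) : M := φ.1 (projIcc 0 1 zero_le_one p.2) p.1

theorem continuous_evalPath (φ : HomeoPath M) : Continuous (evalPath φ) := by
  have h : Continuous fun p : M × ℝ =>
      (φ.1 (projIcc 0 1 zero_le_one p.2) : C(M, M)) p.1 :=
    ((continuous_homeoPath_toContinuousMap φ).comp
      (continuous_projIcc.comp continuous_snd)).eval continuous_fst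
  exact h

theorem evalPath_coe (φ : HomeoPath M) (t : unitInterval) (x : M) :
    evalPath φ (x, t) = φ.1 t x := by
  rw [evalPath, projIcc_val]

theorem evalPath_inv_right (φ : HomeoPath M) (x : M) (s : ℝ) :
    evalPath φ (evalPath φ⁻¹ (x, s), s) = x :=
  (φ.1 (projIcc 0 1 zero_le_one s)).apply_symm_apply x

/-- The isotopy `φ` in the charts `e` and `e'`. -/
def localRep (φ : HomeoPath M) (e e' : OpenPartialHomeomorph M (E n)) (p : E n × ℝ) : E n :=
  e' (evalPath φ (e.symm p.1, p.2))

/-- The space-time points, with arbitrary time, at which `localRep` represents `φ`. -/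
def repNhd (φ : HomeoPath M) (e e' : OpenPartialHomeomorph M (E n)) : Set (E n × ℝ) :=
  {p | p.1 ∈ e.target ∧ evalPath φ (e.symm p.1, p.2) ∈ e'.source}

/-- The domain on which `localRep` represents `φ`. -/
def repDomain (φ : HomeoPath M) (e e' : OpenPartialHomeomorph M (E n)) : Set (E n × ℝ) :=
  repNhd φ e e' ∩ univ ×ˢ Icc 0 1

variable (φ : HomeoPath M) (e e' : OpenPartialHomeomorph M (E n))

theorem isOpen_repNhd : IsOpen (repNhd φ e e') := by
  have hc : ContinuousOn (fun p : E n × ℝ => evalPath φ (e.symm p.1, p.2)) (e.target ×ˢ univ) :=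
    (continuous_evalPath φ).comp_continuousOn
      ((e.continuousOn_symm.comp continuousOn_fst fun p hp => hp.1).prodMk continuousOn_snd)
  have h := hc.isOpen_inter_preimage (e.open_target.prod isOpen_univ) e'.open_source
  convert h using 1
  ext p
  simp [repNhd]

theorem uniqueDiffOn_repDomain : UniqueDiffOn ℝ (repDomain φ e e') := by
  rw [repDomain, inter_comm]
  exact (uniqueDiffOn_univ.prod (uniqueDiffOn_Icc zero_lt_one)).inter (isOpen_repNhd φ e e')

/-- Points at the times `0` and `1` are limits of interior points, so that second derivatives within
the domain are symmetric there too. -/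
theorem repDomain_subset_closure_interior :
    repDomain φ e e' ⊆ closure (interior (repDomain φ e e')) := by
  have hopen : IsOpen (repNhd φ e e' ∩ univ ×ˢ Ioo 0 1) :=
    (isOpen_repNhd φ e e').inter (isOpen_univ.prod isOpen_Ioo)
  have hsub : repNhd φ e e' ∩ univ ×ˢ Ioo 0 1 ⊆ interior (repDomain φ e e') :=
    interior_maximal (inter_subset_inter_right _ (prod_mono_right Ioo_subset_Icc_self)) hopen
  refine Subset.trans ?_ (closure_mono hsub)
  refine Subset.trans ?_ (isOpen_repNhd φ e e').inter_closure
  rw [closure_prod_eq, closure_univ, closure_Ioo zero_ne_one]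
  exact Subset.rfl

theorem mem_repDomain {y : E n} {t : unitInterval} :
    (y, (t : ℝ)) ∈ repDomain φ e e' ↔ y ∈ e.target ∧ φ.1 t (e.symm y) ∈ e'.source := by
  simp only [repDomain, repNhd, mem_inter_iff, mem_ofPred_eq, mem_prod, mem_univ, true_and,
    evalPath_coe]
  exact and_iff_left t.2

theorem mem_repDomain_chart {x : M} {t : unitInterval} (hx : x ∈ e.source)
    (hx' : φ.1 t x ∈ e'.source) : (e x, (t : ℝ)) ∈ repDomain φ e e' :=
  (mem_repDomain φ e e').2 ⟨e.map_source hx, by rwa [e.left_inv hx]⟩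

variable {φ e e'}

theorem localRep_inv_mem {z : E n} {s : ℝ} (h : (z, s) ∈ repDomain φ⁻¹ e' e) :
    (localRep φ⁻¹ e' e (z, s), s) ∈ repDomain φ e e' := by
  refine ⟨⟨e.map_source h.1.2, ?_⟩, h.2⟩
  rw [localRep, e.left_inv h.1.2, evalPath_inv_right]
  exact e'.map_target h.1.1

theorem localRep_localRep_inv {z : E n} {s : ℝ} (h : (z, s) ∈ repDomain φ⁻¹ e' e) :
    localRep φ e e' (localRep φ⁻¹ e' e (z, s), s) = z := by
  rw [localRep, localRep, e.left_inv h.1.2, evalPath_inv_right, e'.right_inv h.1.1]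

theorem localRep_chart {x : M} (hx : x ∈ e.source) (s : ℝ) :
    localRep φ e e' (e x, s) = e' (evalPath φ (x, s)) := by
  rw [localRep, e.left_inv hx]

variable [ChartedSpace (E n) M]

theorem contDiffOn_localRep (hφ : IsIsotopy n φ)
    (he : e ∈ IsManifold.maximalAtlas 𝓘(ℝ, E n) ∞ M)
    (he' : e' ∈ IsManifold.maximalAtlas 𝓘(ℝ, E n) ∞ M) :
    ContDiffOn ℝ ∞ (localRep φ e e') (repDomain φ e e') := by
  rw [← contMDiffOn_prod_iff_contDiffOn]
  have h1 := contMDiffOn_of_mem_maximalAtlas he'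
  have h2 : ContMDiffOn (𝓘(ℝ, E n).prod 𝓘(ℝ, ℝ)) (𝓘(ℝ, E n).prod 𝓘(ℝ, ℝ)) ∞
      (fun p : E n × ℝ => (e.symm p.1, p.2)) (repDomain φ e e') :=
    ((contMDiffOn_symm_of_mem_maximalAtlas he).comp contMDiffOn_fst
      fun p hp => hp.1.1).prodMk contMDiffOn_snd
  have h3 := hφ.1.comp h2 fun p hp => ⟨mem_univ _, hp.2.2⟩
  exact h1.comp h3 fun p hp => hp.1.2

theorem contMDiff_time (hφ : IsIsotopy n φ) (t : unitInterval) :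
    ContMDiff 𝓘(ℝ, E n) 𝓘(ℝ, E n) ∞ (φ.1 t) := by
  have h : ContMDiffOn 𝓘(ℝ, E n) (𝓘(ℝ, E n).prod 𝓘(ℝ, ℝ)) ∞
      (fun x : M => (x, (t : ℝ))) univ := contMDiffOn_id.prodMk contMDiffOn_const
  have h' := hφ.1.comp h fun p _ => ⟨mem_univ _, t.2⟩
  rw [contMDiffOn_univ] at h'
  convert h' using 1
  ext x
  exact (evalPath_coe φ t x).symm

theorem mdifferentiableAt_time (hφ : IsIsotopy n φ) (t : unitInterval) (x : M) :
    MDifferentiableAt 𝓘(ℝ, E n) 𝓘(ℝ, E n) (φ.1 t) x :=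
  (contMDiff_time hφ t).mdifferentiableAt (by simp)

theorem mdifferentiableAt_time_symm (hφ : IsIsotopy n φ) (t : unitInterval) (x : M) :
    MDifferentiableAt 𝓘(ℝ, E n) 𝓘(ℝ, E n) (φ.1 t).symm x :=
  (hφ.2 t).mdifferentiableAt (by simp)

/-- The space derivative of the local representative. -/
theorem hasFDerivAt_localRep_space (hφ : IsIsotopy n φ)
    (he : e ∈ IsManifold.maximalAtlas 𝓘(ℝ, E n) ∞ M)
    (he' : e' ∈ IsManifold.maximalAtlas 𝓘(ℝ, E n) ∞ M) {y : E n} {s : ℝ}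
    (h : (y, s) ∈ repDomain φ e e') :
    HasFDerivAt (fun y => localRep φ e e' (y, s))
      ((fderivWithin ℝ (localRep φ e e') (repDomain φ e e') (y, s)).comp
        (ContinuousLinearMap.inl ℝ (E n) ℝ)) y := by
  have hd := ((contDiffOn_localRep hφ he he').differentiableOn (by simp) _ h).hasFDerivWithinAt
  have hin : HasFDerivAt (fun y : E n => (y, s)) (ContinuousLinearMap.inl ℝ (E n) ℝ) y :=
    hasFDerivAt_prodMk_left y s
  refine (hd.comp y (hin.hasFDerivWithinAt (s := {y | (y, s) ∈ repDomain φ e e'}))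
    fun y hy => hy).hasFDerivAt ?_
  have hopen : IsOpen {y : E n | (y, s) ∈ repNhd φ e e'} :=
    (isOpen_repNhd φ e e').preimage (by fun_prop)
  filter_upwards [hopen.mem_nhds h.1] with z hz using ⟨hz, h.2⟩

/-- The space derivative of the local representative is injective, being the derivative of a
diffeomorphism. -/
theorem fderivWithin_localRep_space_injective (hφ : IsIsotopy n φ)
    (he : e ∈ IsManifold.maximalAtlas 𝓘(ℝ, E n) ∞ M)
    (he' : e' ∈ IsManifold.maximalAtlas 𝓘(ℝ, E n) ∞ M) {y : E n} {t : unitInterval}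
    (h : (y, (t : ℝ)) ∈ repDomain φ e e') {v : E n}
    (hv : fderivWithin ℝ (localRep φ e e') (repDomain φ e e') (y, t) (v, 0) = 0) : v = 0 := by
  have hF := hasFDerivAt_localRep_space hφ he he' h
  have hmem : localRep φ e e' (y, t) ∈ e'.target := e'.map_source h.1.2
  have hsymm : e'.symm (localRep φ e e' (y, t)) = φ.1 t (e.symm y) := by
    rw [localRep, e'.left_inv h.1.2, evalPath_coe]
  have hG : DifferentiableAt ℝ (fun z => e ((φ.1 t).symm (e'.symm z)))
      (localRep φ e e' (y, t)) := by
    rw [← mdifferentiableAt_iff_differentiableAt]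
    have hy : (φ.1 t).symm (e'.symm (localRep φ e e' (y, t))) ∈ e.source := by
      rw [hsymm, Homeomorph.symm_apply_apply]
      exact e.map_target h.1.1
    have h1 : MDifferentiableAt 𝓘(ℝ, E n) 𝓘(ℝ, E n) ((φ.1 t).symm ∘ e'.symm)
        (localRep φ e e' (y, t)) :=
      (mdifferentiableAt_time_symm hφ t _).comp _ (mdifferentiableAt_chart_symm he' hmem)
    exact MDifferentiableAt.comp (localRep φ e e' (y, t)) (mdifferentiableAt_chart he hy) h1
  have hcomp := hG.hasFDerivAt.comp y hF
  have hid : (fun z => e ((φ.1 t).symm (e'.symm z))) ∘ (fun y => localRep φ e e' (y, t))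
      =ᶠ[𝓝 y] id := by
    have hopen : IsOpen {y : E n | (y, (t : ℝ)) ∈ repNhd φ e e'} :=
      (isOpen_repNhd φ e e').preimage (by fun_prop)
    filter_upwards [hopen.mem_nhds h.1] with z hz
    rw [Function.comp_apply, localRep, e'.left_inv hz.2, evalPath_coe,
      Homeomorph.symm_apply_apply, e.right_inv hz.1, id]
  have heq := (hcomp.congr_of_eventuallyEq hid.symm).unique (hasFDerivAt_id y)
  have := congrArg (fun L : E n →L[ℝ] E n => L v) heq
  simpa [hv] using this.symm

/-- The inverse isotopy is smooth in charts, by inverting the space-time map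
`(y, s) ↦ (localRep φ e e' (y, s), s)`. -/
theorem contDiffOn_localRep_inv (hφ : IsIsotopy n φ)
    (he : e ∈ IsManifold.maximalAtlas 𝓘(ℝ, E n) ∞ M)
    (he' : e' ∈ IsManifold.maximalAtlas 𝓘(ℝ, E n) ∞ M) :
    ContDiffOn ℝ ∞ (localRep φ⁻¹ e' e) (repDomain φ⁻¹ e' e) := by
  have hF := contDiffOn_localRep hφ he he'
  have hud := uniqueDiffOn_repDomain φ e e'
  have hcont : ContinuousOn (localRep φ⁻¹ e' e) (repDomain φ⁻¹ e' e) := by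
    refine e.continuousOn.comp ((continuous_evalPath _).comp_continuousOn
      ((e'.continuousOn_symm.comp continuousOn_fst fun p hp => hp.1.1).prodMk continuousOn_snd))
      fun p hp => hp.1.2
  have key := contDiffOn_rightInverse (f := fun p : E n × ℝ => (localRep φ e e' p, p.2))
    (g := fun p => (localRep φ⁻¹ e' e p, p.2)) (hF.prodMk contDiffOn_snd) hud
    (uniqueDiffOn_repDomain φ⁻¹ e' e) (hcont.prodMk continuousOn_snd)
    (fun p hp => localRep_inv_mem hp)
    (fun p hp => Prod.ext (localRep_localRep_inv hp) rfl) ?_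
  · exact contDiff_fst.comp_contDiffOn key
  · rintro ⟨z, s⟩ hp
    set q : E n × ℝ := (localRep φ⁻¹ e' e (z, s), s) with hq
    have hqm : q ∈ repDomain φ e e' := localRep_inv_mem hp
    have hd : HasFDerivWithinAt (fun p : E n × ℝ => (localRep φ e e' p, p.2))
        ((fderivWithin ℝ (localRep φ e e') (repDomain φ e e') q).prod
          (ContinuousLinearMap.snd ℝ (E n) ℝ)) (repDomain φ e e') q :=
      ((hF.differentiableOn (by simp) q hqm).hasFDerivWithinAt).prodMk hasFDerivWithinAt_snd
    change (fderivWithin ℝ (fun p : E n × ℝ => (localRep φ e e' p, p.2))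
      (repDomain φ e e') q).IsInvertible
    rw [hd.fderivWithin (hud q hqm)]
    set L := (fderivWithin ℝ (localRep φ e e') (repDomain φ e e') q).prod
          (ContinuousLinearMap.snd ℝ (E n) ℝ) with hL
    have hinj : Function.Injective (L : E n × ℝ →ₗ[ℝ] E n × ℝ) := by
      refine (injective_iff_map_eq_zero _).2 ?_
      rintro ⟨v, r⟩ hvr
      have h1 := congrArg Prod.fst hvr
      have h2 := congrArg Prod.snd hvr
      simp only [hL, ContinuousLinearMap.coe_coe, ContinuousLinearMap.prod_apply,
        ContinuousLinearMap.coe_snd', Prod.snd_zero, Prod.fst_zero] at h1 h2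
      subst h2
      have hv := fderivWithin_localRep_space_injective (t := ⟨s, hp.2.2⟩) hφ he he' hqm h1
      rw [hv]
      rfl
    exact ⟨(LinearEquiv.ofInjectiveEndo _ hinj).toContinuousLinearEquiv, by ext p <;> rfl⟩

theorem isIsotopy_inv [IsManifold 𝓘(ℝ, E n) ∞ M] (hφ : IsIsotopy n φ) : IsIsotopy n φ⁻¹ := by
  refine ⟨?_, fun t => contMDiff_time hφ t⟩
  rintro ⟨x, s⟩ hp
  have hs : s ∈ Icc (0 : ℝ) 1 := hp.2
  set e := chartAt (E n) (evalPath φ⁻¹ (x, s)) with he_def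
  set e' := chartAt (E n) x with he'_def
  have he : e ∈ IsManifold.maximalAtlas 𝓘(ℝ, E n) ∞ M := IsManifold.chart_mem_maximalAtlas _
  have he' : e' ∈ IsManifold.maximalAtlas 𝓘(ℝ, E n) ∞ M := IsManifold.chart_mem_maximalAtlas _
  have hx : x ∈ e'.source := mem_chart_source _ _
  have hxs : evalPath φ⁻¹ (x, s) ∈ e.source := mem_chart_source _ _
  set T : Set (M × ℝ) :=
    (e'.source ×ˢ univ ∩ evalPath φ⁻¹ ⁻¹' e.source) ∩ univ ×ˢ Icc 0 1 with hT
  have hG := contMDiffOn_prod_iff_contDiffOn.2 (contDiffOn_localRep_inv hφ he he')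
  have h1 : ContMDiffOn (𝓘(ℝ, E n).prod 𝓘(ℝ, ℝ)) (𝓘(ℝ, E n).prod 𝓘(ℝ, ℝ)) ∞
      (fun p : M × ℝ => (e' p.1, p.2)) T :=
    ((contMDiffOn_of_mem_maximalAtlas he').comp contMDiffOn_fst
      fun p hp => hp.1.1.1).prodMk contMDiffOn_snd
  have h2 := hG.comp h1 fun p hp => ⟨⟨e'.map_source hp.1.1.1, by
    rw [e'.left_inv hp.1.1.1]
    exact hp.1.2⟩, hp.2⟩
  have h3 := (contMDiffOn_symm_of_mem_maximalAtlas he).comp h2 fun p hp => by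
    refine e.map_source ?_
    simp only
    rw [e'.left_inv hp.1.1.1]
    exact hp.1.2
  have h4 : ContMDiffOn (𝓘(ℝ, E n).prod 𝓘(ℝ, ℝ)) 𝓘(ℝ, E n) ∞ (evalPath φ⁻¹) T := by
    refine h3.congr fun p hp => ?_
    simp only [Function.comp_apply, localRep]
    rw [e'.left_inv hp.1.1.1, e.left_inv hp.1.2]
  have hopen : IsOpen (e'.source ×ˢ univ ∩ evalPath φ⁻¹ ⁻¹' e.source) :=
    (e'.open_source.prod isOpen_univ).inter (e.open_source.preimage (continuous_evalPath _))
  have h5 := h4 (x, s) ⟨⟨⟨hx, mem_univ _⟩, hxs⟩, hp⟩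
  refine h5.mono_of_mem_nhdsWithin ?_
  exact inter_mem (mem_nhdsWithin_of_mem_nhds (hopen.mem_nhds ⟨⟨hx, mem_univ _⟩, hxs⟩))
    self_mem_nhdsWithin

theorem isIsotopy_mul {ψ : HomeoPath M} (hφ : IsIsotopy n φ) (hψ : IsIsotopy n ψ) :
    IsIsotopy n (φ * ψ) := by
  refine ⟨?_, fun t => (hψ.2 t).comp (hφ.2 t)⟩
  exact hφ.1.comp (hψ.1.prodMk contMDiffOn_snd) fun p hp => ⟨mem_univ _, hp.2⟩

theorem isIsotopy_one : IsIsotopy n (1 : HomeoPath M) :=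
  ⟨contMDiffOn_fst, fun _ => contMDiff_id⟩

end LocalRepresentative

/-! ### The derivative of the pull-back of a one-form along an isotopy -/

section ChartDerivatives

variable {n : ℕ} {M : Type*} [TopologicalSpace M] [ChartedSpace (E n) M]

theorem mfderiv_congr_vectorField (e : OpenPartialHomeomorph M (E n)) {x x' : M} (h : x = x')
    (X : VectorField n M) :
    (mfderiv 𝓘(ℝ, E n) 𝓘(ℝ, E n) e x (X x) : E n) = mfderiv 𝓘(ℝ, E n) 𝓘(ℝ, E n) e x' (X x') := by
  rw [h]

theorem mfderiv_congr_point_apply (f : M → E n) {x x' : M} (h : x = x') (v : E n) :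
    (mfderiv 𝓘(ℝ, E n) 𝓘(ℝ, E n) f x v : E n) = mfderiv 𝓘(ℝ, E n) 𝓘(ℝ, E n) f x' v := by
  rw [h]

/-- The value of a one-form on a vector can be computed in a chart. -/
theorem oneForm_apply_eq_inChart (α : OneForm n M) {e : OpenPartialHomeomorph M (E n)}
    (he : e ∈ IsManifold.maximalAtlas 𝓘(ℝ, E n) ∞ M) {x : M} (hx : x ∈ e.source)
    (v : TangentSpace 𝓘(ℝ, E n) x) :
    α x v = α.inChart e (e x) (mfderiv 𝓘(ℝ, E n) 𝓘(ℝ, E n) e x v) := by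
  have h := inChart_comp α he (g := id) (f := e) (y := x) (e.map_source hx)
    (mdifferentiableAt_chart he hx) (by
      filter_upwards [e.open_source.mem_nhds hx] with z hz using (e.left_inv hz).symm)
  rw [mfderiv_id] at h
  exact congrArg (fun L : E n →L[ℝ] ℝ => L v) h

end ChartDerivatives

section Velocity

variable {n : ℕ} {M : Type*} [MetricSpace M] [CompactSpace M] {φ ψ : HomeoPath M}
  {e e' : OpenPartialHomeomorph M (E n)}

theorem repDomain_slice_mem_nhdsWithin {y : E n} {t : unitInterval}
    (h : (y, (t : ℝ)) ∈ repDomain φ e e') :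
    {s : ℝ | (y, s) ∈ repDomain φ e e'} ∈ 𝓝[Icc 0 1] (t : ℝ) := by
  have hopen : IsOpen {s : ℝ | (y, s) ∈ repNhd φ e e'} :=
    (isOpen_repNhd φ e e').preimage (by fun_prop)
  filter_upwards [mem_nhdsWithin_of_mem_nhds (hopen.mem_nhds h.1), self_mem_nhdsWithin]
    with s hs hs' using ⟨hs, mem_univ _, hs'⟩

theorem hasDerivWithinAt_repDomain_time {F : Type*} [NormedAddCommGroup F] [NormedSpace ℝ F]
    {f : E n × ℝ → F} {f' : E n × ℝ →L[ℝ] F} {y : E n} {t : unitInterval}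
    (h : (y, (t : ℝ)) ∈ repDomain φ e e')
    (hf : HasFDerivWithinAt f f' (repDomain φ e e') (y, t)) :
    HasDerivWithinAt (fun s => f (y, s)) (f' (0, 1)) (Icc 0 1) t := by
  have hin : HasDerivWithinAt (fun s : ℝ => (y, s)) ((0 : E n), (1 : ℝ))
      {s : ℝ | (y, s) ∈ repDomain φ e e'} t :=
    (hasDerivWithinAt_const _ _ _).prodMk (hasDerivWithinAt_id _ _)
  exact (hf.comp_hasDerivWithinAt (t : ℝ) hin fun s hs => hs).mono_of_mem_nhdsWithin
    (repDomain_slice_mem_nhdsWithin h)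

variable [ChartedSpace (E n) M]

theorem velocity_apply_time (φ : HomeoPath M) (t : unitInterval) (w : M) :
    velocity n φ t (φ.1 t w) = (mfderivWithin 𝓘(ℝ, ℝ) 𝓘(ℝ, E n)
      (fun s : ℝ => evalPath φ (w, s)) (Icc 0 1) (t : ℝ) (1 : ℝ) : E n) := by
  have hcongr : ∀ f g : ℝ → M, f = g →
      (mfderivWithin 𝓘(ℝ, ℝ) 𝓘(ℝ, E n) f (Icc 0 1) (t : ℝ) (1 : ℝ) : E n) =
        (mfderivWithin 𝓘(ℝ, ℝ) 𝓘(ℝ, E n) g (Icc 0 1) (t : ℝ) (1 : ℝ) : E n) := by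
    rintro f _ rfl
    rfl
  refine hcongr _ _ (funext fun s => ?_)
  rw [Homeomorph.symm_apply_apply, evalPath]

theorem mdifferentiableWithinAt_path (hφ : IsIsotopy n φ) (t : unitInterval) (w : M) :
    MDifferentiableWithinAt 𝓘(ℝ, ℝ) 𝓘(ℝ, E n) (fun s : ℝ => evalPath φ (w, s)) (Icc 0 1) t := by
  have h : ContMDiffOn 𝓘(ℝ, ℝ) (𝓘(ℝ, E n).prod 𝓘(ℝ, ℝ)) ∞
      (fun s : ℝ => (w, s)) (Icc 0 1) := contMDiffOn_const.prodMk contMDiffOn_id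
  have h' := hφ.1.comp h fun s hs => ⟨mem_univ _, hs⟩
  exact (h' t t.2).mdifferentiableWithinAt (by simp)

/-- The velocity in a chart is the derivative of the path in that chart. -/
theorem velocity_inChart (hφ : IsIsotopy n φ)
    (he' : e' ∈ IsManifold.maximalAtlas 𝓘(ℝ, E n) ∞ M) {t : unitInterval} {w : M}
    (hw : φ.1 t w ∈ e'.source) :
    HasDerivWithinAt (fun s => e' (evalPath φ (w, s)))
      ((velocity n φ t).inChart e' (e' (φ.1 t w))) (Icc 0 1) t := by
  have hw' : evalPath φ (w, t) ∈ e'.source := by rwa [evalPath_coe]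
  have hc := mdifferentiableWithinAt_path hφ t w
  have hud : UniqueMDiffWithinAt 𝓘(ℝ, ℝ) (Icc (0 : ℝ) 1) t :=
    (uniqueDiffOn_Icc zero_lt_one t t.2).uniqueMDiffWithinAt
  have hcomp := mfderiv_comp_mfderivWithin (t : ℝ) (mdifferentiableAt_chart he' hw') hc hud
  have hd : DifferentiableWithinAt ℝ (e' ∘ fun s => evalPath φ (w, s)) (Icc 0 1) t :=
    mdifferentiableWithinAt_iff_differentiableWithinAt.1
      ((mdifferentiableAt_chart he' hw').comp_mdifferentiableWithinAt (t : ℝ) hc)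
  rw [mfderivWithin_eq_fderivWithin] at hcomp
  have h1 : derivWithin (e' ∘ fun s => evalPath φ (w, s)) (Icc 0 1) t =
      (velocity n φ t).inChart e' (e' (φ.1 t w)) := by
    unfold VectorField.inChart
    rw [mfderiv_congr_vectorField e' (e'.left_inv hw), velocity_apply_time]
    have h2 := congrArg (fun L : ℝ →L[ℝ] E n => L 1) hcomp
    refine Eq.trans h2 ?_
    exact mfderiv_congr_point_apply e' (evalPath_coe φ t w) _
  rw [← h1]
  exact hd.hasDerivWithinAt

theorem velocity_inChart_eq (hφ : IsIsotopy n φ)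
    (he : e ∈ IsManifold.maximalAtlas 𝓘(ℝ, E n) ∞ M)
    (he' : e' ∈ IsManifold.maximalAtlas 𝓘(ℝ, E n) ∞ M) {t : unitInterval} {w : M}
    (hwe : w ∈ e.source) (hw : φ.1 t w ∈ e'.source) :
    (velocity n φ t).inChart e' (e' (φ.1 t w)) =
      fderivWithin ℝ (localRep φ e e') (repDomain φ e e') (e w, t) (0, 1) := by
  have hmem := mem_repDomain_chart φ e e' hwe hw
  have h1 := hasDerivWithinAt_repDomain_time hmem
    ((contDiffOn_localRep hφ he he').differentiableOn (by simp) _ hmem).hasFDerivWithinAt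
  simp only [localRep_chart hwe] at h1
  exact (uniqueDiffOn_Icc zero_lt_one t t.2).eq_deriv _ (velocity_inChart hφ he' hw) h1

/-- The pull-back `(φ_t^* α)_x` in charts. -/
theorem pullback_eq_inChart (α : OneForm n M) (hφ : IsIsotopy n φ)
    (he : e ∈ IsManifold.maximalAtlas 𝓘(ℝ, E n) ∞ M)
    (he' : e' ∈ IsManifold.maximalAtlas 𝓘(ℝ, E n) ∞ M) {t : unitInterval} {x : M}
    (hx : x ∈ e.source) (hx' : φ.1 t x ∈ e'.source) (v : TangentSpace 𝓘(ℝ, E n) x) :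
    α (φ.1 t x) (mfderiv 𝓘(ℝ, E n) 𝓘(ℝ, E n) (φ.1 t) x v) =
      α.inChart e' (localRep φ e e' (e x, t))
        (fderivWithin ℝ (localRep φ e e') (repDomain φ e e') (e x, t)
          (mfderiv 𝓘(ℝ, E n) 𝓘(ℝ, E n) e x v, 0)) := by
  have hmem := mem_repDomain_chart φ e e' hx hx'
  have hopen : IsOpen (e.source ∩ φ.1 t ⁻¹' e'.source) :=
    e.open_source.inter (e'.open_source.preimage (φ.1 t).continuous)
  have hd1 : MDifferentiableAt 𝓘(ℝ, E n) 𝓘(ℝ, E n) (e' ∘ φ.1 t) x :=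
    (mdifferentiableAt_chart he' hx').comp x (mdifferentiableAt_time hφ t x)
  have h := inChart_comp α he' (g := φ.1 t) (f := e' ∘ φ.1 t) (y := x) (e'.map_source hx') hd1 (by
    filter_upwards [hopen.mem_nhds ⟨hx, hx'⟩] with z hz using (e'.left_inv hz.2).symm)
  have hF := hasFDerivAt_localRep_space hφ he he' hmem
  have heq : (e' ∘ φ.1 t) =ᶠ[𝓝 x] (fun y => localRep φ e e' (y, t)) ∘ e := by
    filter_upwards [hopen.mem_nhds ⟨hx, hx'⟩] with z hz
    rw [Function.comp_apply, Function.comp_apply, localRep_chart hz.1, evalPath_coe]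
  have h2 := mfderiv_comp x hF.differentiableAt.mdifferentiableAt (mdifferentiableAt_chart he hx)
  rw [mfderiv_eq_fderiv, hF.fderiv] at h2
  rw [heq.mfderiv_eq, h2] at h
  have h3 := congrArg (fun L : E n →L[ℝ] ℝ => L v) h
  have h4 : (e' ∘ φ.1 t) x = localRep φ e e' (e x, t) := heq.eq_of_nhds
  rw [← h4]
  exact h3

/-- The Lie derivative `L_X α` in a chart. -/
def lieInChart (α : OneForm n M) (X : VectorField n M) (e : OpenPartialHomeomorph M (E n))
    (y v : E n) : ℝ :=
  fderiv ℝ (α.inChart e) y (X.inChart e y) v + α.inChart e y (fderiv ℝ (X.inChart e) y v)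

/-- The derivative in space of the velocity, by differentiating
`X_t(z) = ∂_t φ_t (φ_t⁻¹ z)` in charts. -/
theorem fderiv_velocity_inChart (hφ : IsIsotopy n φ)
    (he : e ∈ IsManifold.maximalAtlas 𝓘(ℝ, E n) ∞ M)
    (he' : e' ∈ IsManifold.maximalAtlas 𝓘(ℝ, E n) ∞ M) {t : unitInterval} {x : M}
    (hx : x ∈ e.source) (hx' : φ.1 t x ∈ e'.source) (v : E n) :
    fderiv ℝ ((velocity n φ t).inChart e') (e' (φ.1 t x))
        (fderivWithin ℝ (localRep φ e e') (repDomain φ e e') (e x, t) (v, 0)) =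
      fderivWithin ℝ (fderivWithin ℝ (localRep φ e e') (repDomain φ e e')) (repDomain φ e e')
        (e x, t) (v, 0) (0, 1) := by
  set F := localRep φ e e' with hF_def
  set W := repDomain φ e e' with hW_def
  set D := fderivWithin ℝ F W with hD_def
  set z := e' (φ.1 t x) with hz_def
  have hmem : (e x, (t : ℝ)) ∈ W := mem_repDomain_chart φ e e' hx hx'
  have hz : z ∈ e'.target := e'.map_source hx'
  have hsymm : e'.symm z = φ.1 t x := e'.left_inv hx'
  set G : E n → E n := fun z => e ((φ.1 t).symm (e'.symm z)) with hG_def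
  have hGz : G z = e x := by rw [hG_def]; simp only; rw [hsymm, Homeomorph.symm_apply_apply]
  -- near `z` the velocity is `D (G ·, t) (0, 1)`
  have hN : e'.target ∩ e'.symm ⁻¹' ((φ.1 t).symm ⁻¹' e.source) ∈ 𝓝 z := by
    refine (e'.isOpen_inter_preimage_symm
      (e.open_source.preimage (φ.1 t).symm.continuous)).mem_nhds ⟨hz, ?_⟩
    rw [mem_preimage, hsymm, mem_preimage, Homeomorph.symm_apply_apply]
    exact hx
  have hmaps : ∀ z' ∈ e'.target ∩ e'.symm ⁻¹' ((φ.1 t).symm ⁻¹' e.source),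
      (G z', (t : ℝ)) ∈ W := by
    intro z' hz'
    refine mem_repDomain_chart φ e e' hz'.2 ?_
    rw [Homeomorph.apply_symm_apply]
    exact e'.map_target hz'.1
  have hV : (velocity n φ t).inChart e' =ᶠ[𝓝 z] fun z' => D (G z', t) (0, 1) := by
    filter_upwards [hN] with z' hz'
    have h := velocity_inChart_eq hφ he he' (t := t) (w := (φ.1 t).symm (e'.symm z')) hz'.2
      (by rw [Homeomorph.apply_symm_apply]; exact e'.map_target hz'.1)
    rwa [Homeomorph.apply_symm_apply, e'.right_inv hz'.1] at h
  have hG : DifferentiableAt ℝ G z := by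
    rw [← mdifferentiableAt_iff_differentiableAt]
    have h1 : MDifferentiableAt 𝓘(ℝ, E n) 𝓘(ℝ, E n) ((φ.1 t).symm ∘ e'.symm) z :=
      (mdifferentiableAt_time_symm hφ t _).comp z (mdifferentiableAt_chart_symm he' hz)
    refine MDifferentiableAt.comp z (mdifferentiableAt_chart he ?_) h1
    exact (mem_of_mem_nhds hN).2
  -- `G` inverts the space derivative of the representative
  have hGD : fderiv ℝ G z (D (e x, t) (v, 0)) = v := by
    have hF := hasFDerivAt_localRep_space hφ he he' hmem
    have hFz : F (e x, t) = z := by rw [hF_def, localRep_chart hx, evalPath_coe]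
    have hG' : HasFDerivAt G (fderiv ℝ G z) (F (e x, t)) := by
      rw [hFz]
      exact hG.hasFDerivAt
    have hcomp := hG'.comp (e x) hF
    have hid : G ∘ (fun y => F (y, (t : ℝ))) =ᶠ[𝓝 (e x)] id := by
      have hopen : IsOpen {y : E n | (y, (t : ℝ)) ∈ repNhd φ e e'} :=
        (isOpen_repNhd φ e e').preimage (by fun_prop)
      filter_upwards [hopen.mem_nhds hmem.1] with y hy
      rw [Function.comp_apply, hG_def, hF_def]
      simp only
      rw [localRep, e'.left_inv hy.2, evalPath_coe, Homeomorph.symm_apply_apply,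
        e.right_inv hy.1, id]
    have heq := (hcomp.congr_of_eventuallyEq hid.symm).unique (hasFDerivAt_id (e x))
    exact congrArg (fun L : E n →L[ℝ] E n => L v) heq
  have hD : HasFDerivWithinAt D (fderivWithin ℝ D W (e x, t)) W (e x, t) :=
    (((contDiffOn_localRep hφ he he').fderivWithin (uniqueDiffOn_repDomain φ e e')
      (m := 1) two_le_infty).differentiableOn (by simp) _ hmem).hasFDerivWithinAt
  have hGt : HasFDerivAt (fun z' => (G z', (t : ℝ)))
      ((fderiv ℝ G z).prod (0 : E n →L[ℝ] ℝ)) z :=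
    hG.hasFDerivAt.prodMk (hasFDerivAt_const _ _)
  have hD' : HasFDerivWithinAt D (fderivWithin ℝ D W (e x, t)) W (G z, (t : ℝ)) := by rwa [hGz]
  have hcomp := (hD'.comp z (hGt.hasFDerivWithinAt (s := e'.target ∩
    e'.symm ⁻¹' ((φ.1 t).symm ⁻¹' e.source))) hmaps).hasFDerivAt hN
  have hfinal := hcomp.clm_apply (hasFDerivAt_const ((0 : E n), (1 : ℝ)) z)
  rw [hV.fderiv_eq]
  have h2 : fderiv ℝ (fun z' => D (G z', (t : ℝ)) (0, 1)) z = _ := hfinal.fderiv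
  rw [h2]
  simp [hGD]

/-- The formula `d/dt (φ_t^* α) = φ_t^* (L_{X_t} α)` for the velocity `X_t` of an isotopy. -/
theorem hasDerivWithinAt_pullback {α : OneForm n M} (hα : α.IsSmooth) (hφ : IsIsotopy n φ)
    (he : e ∈ IsManifold.maximalAtlas 𝓘(ℝ, E n) ∞ M)
    (he' : e' ∈ IsManifold.maximalAtlas 𝓘(ℝ, E n) ∞ M) {t : unitInterval} {x : M}
    (hx : x ∈ e.source) (hx' : φ.1 t x ∈ e'.source) (v : TangentSpace 𝓘(ℝ, E n) x) :
    HasDerivWithinAt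
      (fun s : ℝ => α (φ.1 (projIcc 0 1 zero_le_one s) x)
        (mfderiv 𝓘(ℝ, E n) 𝓘(ℝ, E n) (φ.1 (projIcc 0 1 zero_le_one s)) x v))
      (lieInChart α (velocity n φ t) e' (e' (φ.1 t x))
        (fderivWithin ℝ (localRep φ e e') (repDomain φ e e') (e x, t)
          (mfderiv 𝓘(ℝ, E n) 𝓘(ℝ, E n) e x v, 0))) (Icc 0 1) t := by
  set v' : E n := mfderiv 𝓘(ℝ, E n) 𝓘(ℝ, E n) e x v with hv'
  set F := localRep φ e e' with hF_def
  set W := repDomain φ e e' with hW_def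
  set D := fderivWithin ℝ F W with hD_def
  set a := α.inChart e' with ha_def
  have hmem : (e x, (t : ℝ)) ∈ W := mem_repDomain_chart φ e e' hx hx'
  have hFz : F (e x, t) = e' (φ.1 t x) := by rw [hF_def, localRep_chart hx, evalPath_coe]
  have hsmooth := contDiffOn_localRep hφ he he'
  have hud := uniqueDiffOn_repDomain φ e e'
  have hFd := (hsmooth.differentiableOn (by simp) _ hmem).hasFDerivWithinAt
  have hDd : HasFDerivWithinAt D (fderivWithin ℝ D W (e x, t)) W (e x, t) :=
    ((hsmooth.fderivWithin hud (m := 1) two_le_infty).differentiableOn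
      (by simp) _ hmem).hasFDerivWithinAt
  have had : HasFDerivAt a (fderiv ℝ a (F (e x, t))) (F (e x, t)) := by
    rw [hFz]
    exact (((hα e' he').contDiffAt (e'.open_target.mem_nhds (e'.map_source hx'))).differentiableAt
      (by simp)).hasFDerivAt
  have hsymmetric : IsSymmSndFDerivWithinAt ℝ F W (e x, t) :=
    (hsmooth _ hmem).isSymmSndFDerivWithinAt
      (by simpa [one_add_one_eq_two] using two_le_infty) hud
      (repDomain_subset_closure_interior φ e e' hmem) hmem
  have h1 := had.comp_hasDerivWithinAt (t : ℝ) (hasDerivWithinAt_repDomain_time hmem hFd)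
  have h2 := (hasDerivWithinAt_repDomain_time hmem hDd).clm_apply
    (hasDerivWithinAt_const (t : ℝ) (Icc 0 1) (v', (0 : ℝ)))
  have h3 := h1.clm_apply h2
  have hval : lieInChart α (velocity n φ t) e' (e' (φ.1 t x)) (D (e x, t) (v', 0)) =
      fderiv ℝ a (F (e x, t)) (D (e x, t) (0, 1)) (D (e x, t) (v', 0)) +
        a (F (e x, t)) (fderivWithin ℝ D W (e x, t) (0, 1) (v', 0)) := by
    rw [lieInChart, fderiv_velocity_inChart hφ he he' hx hx', velocity_inChart_eq hφ he he' hx hx',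
      hFz, ← hsymmetric.eq (v', 0) (0, 1)]
  rw [hval]
  have h4 : HasDerivWithinAt (fun s : ℝ => a (F (e x, s)) (D (e x, s) (v', 0)))
      (fderiv ℝ a (F (e x, t)) (D (e x, t) (0, 1)) (D (e x, t) (v', 0)) +
        a (F (e x, t)) (fderivWithin ℝ D W (e x, t) (0, 1) (v', 0))) (Icc 0 1) t := by
    rw [map_zero, add_zero] at h3
    exact h3
  have hev : ∀ s ∈ {s : ℝ | (e x, s) ∈ W}, α (φ.1 (projIcc 0 1 zero_le_one s) x)
      (mfderiv 𝓘(ℝ, E n) 𝓘(ℝ, E n) (φ.1 (projIcc 0 1 zero_le_one s)) x v) =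
        a (F (e x, s)) (D (e x, s) (v', 0)) := by
    intro s hs
    have hs' := hs.2.2
    have h5 : φ.1 (projIcc 0 1 zero_le_one s) x ∈ e'.source := by
      have := hs.1.2
      simp only at this
      rwa [e.left_inv hx] at this
    rw [pullback_eq_inChart α hφ he he' hx h5, projIcc_of_mem zero_le_one hs']
  refine h4.congr_of_eventuallyEq ?_ (hev t hmem)
  filter_upwards [repDomain_slice_mem_nhdsWithin hmem] with s hs using hev s hs

end Velocity

/-! ### Strictly contact isotopies and their generators -/

section Preservation

variable {n : ℕ} {M : Type*} [MetricSpace M] [CompactSpace M] [ChartedSpace (E n) M]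
  {φ ψ : HomeoPath M}

/-- Every time-`t` map of `φ` preserves the one-form: `φ_t^* α = α`. -/
def PreservesForm (α : OneForm n M) (φ : HomeoPath M) : Prop :=
  ∀ (t : unitInterval) (x : M) (v : TangentSpace 𝓘(ℝ, E n) x),
    α (φ.1 t x) (mfderiv 𝓘(ℝ, E n) 𝓘(ℝ, E n) (φ.1 t) x v) = α x v

theorem preservesForm_one (α : OneForm n M) : PreservesForm α (1 : HomeoPath M) := by
  intro t x v
  change α x (mfderiv 𝓘(ℝ, E n) 𝓘(ℝ, E n) id x v) = α x v
  rw [mfderiv_id]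
  rfl

theorem preservesForm_mul {α : OneForm n M} (hφ : IsIsotopy n φ) (hψ : IsIsotopy n ψ)
    (h : PreservesForm α φ) (h' : PreservesForm α ψ) : PreservesForm α (φ * ψ) := by
  intro t x v
  have hcomp := mfderiv_comp x (mdifferentiableAt_time hφ t (ψ.1 t x))
    (mdifferentiableAt_time hψ t x)
  change α (φ.1 t (ψ.1 t x)) (mfderiv 𝓘(ℝ, E n) 𝓘(ℝ, E n) (φ.1 t ∘ ψ.1 t) x v) = α x v
  rw [hcomp]
  exact (h t (ψ.1 t x) _).trans (h' t x v)

theorem preservesForm_inv {α : OneForm n M} (hφ : IsIsotopy n φ) (h : PreservesForm α φ) :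
    PreservesForm α φ⁻¹ := by
  intro t x v
  have hcomp := mfderiv_comp x (mdifferentiableAt_time hφ t ((φ.1 t).symm x))
    (mdifferentiableAt_time_symm hφ t x)
  rw [show φ.1 t ∘ (φ.1 t).symm = id from funext fun y => (φ.1 t).apply_symm_apply y,
    mfderiv_id] at hcomp
  have h1 := h t ((φ.1 t).symm x) (mfderiv 𝓘(ℝ, E n) 𝓘(ℝ, E n) (φ.1 t).symm x v)
  have h2 := congrArg (fun L : E n →L[ℝ] E n => L v) hcomp
  refine Eq.trans h1.symm ?_
  refine (oneForm_congr α ((φ.1 t).apply_symm_apply x) _).trans ?_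
  exact congrArg (α x : E n →L[ℝ] ℝ) h2.symm

variable [IsManifold 𝓘(ℝ, E n) ∞ M]

/-- If `φ_t^* α` is constant in `t`, its derivative `φ_t^* (L_{X_t} α)` vanishes, hence so does
`L_{X_t} α`, as `Dφ_t` is surjective. -/
theorem isStrictlyContactField_of_preservesForm {α : OneForm n M} (hα : α.IsSmooth)
    (hφ : IsIsotopy n φ) (h : PreservesForm α φ) (t : unitInterval) :
    IsStrictlyContactField α (velocity n φ t) := by
  intro e' he' z hz u
  set x := (φ.1 t).symm (e'.symm z) with hx_def
  have hφx : φ.1 t x = e'.symm z := (φ.1 t).apply_symm_apply _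
  have hx' : φ.1 t x ∈ e'.source := by rw [hφx]; exact e'.map_target hz
  set e := chartAt (E n) x with he_def
  have he : e ∈ IsManifold.maximalAtlas 𝓘(ℝ, E n) ∞ M := IsManifold.chart_mem_maximalAtlas x
  have hx : x ∈ e.source := mem_chart_source _ x
  have hmem := mem_repDomain_chart φ e e' hx hx'
  have hsurj : Function.Surjective
      (((fderivWithin ℝ (localRep φ e e') (repDomain φ e e') (e x, t)).comp
        (ContinuousLinearMap.inl ℝ (E n) ℝ) : E n →L[ℝ] E n) : E n →ₗ[ℝ] E n) := by
    refine LinearMap.injective_iff_surjective.1 ((injective_iff_map_eq_zero _).2 fun v hv => ?_)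
    exact fderivWithin_localRep_space_injective hφ he he' hmem hv
  obtain ⟨w, hw⟩ := hsurj u
  have hmd : e.MDifferentiable 𝓘(ℝ, E n) 𝓘(ℝ, E n) :=
    ⟨fun y hy => (mdifferentiableAt_chart he hy).mdifferentiableWithinAt,
      fun y hy => (mdifferentiableAt_chart_symm he hy).mdifferentiableWithinAt⟩
  obtain ⟨v, hv⟩ := hmd.mfderiv_surjective hx w
  have hder := hasDerivWithinAt_pullback hα hφ he he' hx hx' v
  have hconst : (fun s : ℝ => α (φ.1 (projIcc 0 1 zero_le_one s) x)
      (mfderiv 𝓘(ℝ, E n) 𝓘(ℝ, E n) (φ.1 (projIcc 0 1 zero_le_one s)) x v)) = fun _ => α x v :=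
    funext fun s => h _ x v
  rw [hconst] at hder
  have hzero := (uniqueDiffOn_Icc zero_lt_one (t : ℝ) t.2).eq_deriv _ hder
    (hasDerivWithinAt_const (t : ℝ) (Icc 0 1) (α x v))
  rw [hv] at hzero
  have hw' : fderivWithin ℝ (localRep φ e e') (repDomain φ e e') (e x, t) (w, 0) = u := hw
  rw [hφx, e'.right_inv hz] at hzero
  rw [← hw']
  exact hzero

theorem preservesForm_of_isStrictlyContactField {α : OneForm n M} (hα : α.IsSmooth)
    (hφ : IsIsotopy n φ) (h : ∀ t, IsStrictlyContactField α (velocity n φ t)) :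
    PreservesForm α φ := by
  intro t x v
  set f : ℝ → ℝ := fun s : ℝ => α (φ.1 (projIcc 0 1 zero_le_one s) x)
    (mfderiv 𝓘(ℝ, E n) 𝓘(ℝ, E n) (φ.1 (projIcc 0 1 zero_le_one s)) x v) with hf
  have hder : ∀ s ∈ Icc (0 : ℝ) 1, HasDerivWithinAt f 0 (Icc 0 1) s := by
    intro s hs
    have hd := hasDerivWithinAt_pullback (t := ⟨s, hs⟩) hα hφ
      (IsManifold.chart_mem_maximalAtlas x) (IsManifold.chart_mem_maximalAtlas (φ.1 ⟨s, hs⟩ x))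
      (mem_chart_source (E n) x) (mem_chart_source (E n) (φ.1 ⟨s, hs⟩ x)) v
    have hlie := h ⟨s, hs⟩ _ (IsManifold.chart_mem_maximalAtlas (φ.1 ⟨s, hs⟩ x)) _
      ((chartAt (E n) (φ.1 ⟨s, hs⟩ x)).map_source (mem_chart_source (E n) (φ.1 ⟨s, hs⟩ x)))
    rw [lieInChart, hlie] at hd
    exact hd
  have hconst := constant_of_derivWithin_zero (fun s hs => (hder s hs).differentiableWithinAt)
    (fun s hs => (hder s (Ico_subset_Icc_self hs)).derivWithin
      (uniqueDiffOn_Icc zero_lt_one s (Ico_subset_Icc_self hs))) t t.2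
  have h0 : f 0 = α x v := by
    have hφ0 : φ.1 (projIcc 0 1 zero_le_one (0 : ℝ)) = Homeomorph.refl M := by
      rw [projIcc_left]
      exact φ.2
    rw [hf]
    simp only
    rw [hφ0]
    exact preservesForm_one α 0 x v
  rw [h0, hf] at hconst
  simp only at hconst
  rwa [projIcc_val] at hconst

/-- An isotopy is strictly contact exactly when it preserves the contact form. -/
theorem isStrictlyContactIsotopy_iff {α : OneForm n M} (hα : α.IsSmooth) :
    IsStrictlyContactIsotopy α φ ↔ IsIsotopy n φ ∧ PreservesForm α φ :=
  and_congr_right fun hφ => ⟨preservesForm_of_isStrictlyContactField hα hφ,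
    isStrictlyContactField_of_preservesForm hα hφ⟩

end Preservation

section Generator

variable {n : ℕ} {M : Type*} [MetricSpace M] [CompactSpace M] [ChartedSpace (E n) M]
  {φ ψ : HomeoPath M}

theorem generator_eq_inChart (α : OneForm n M) (φ : HomeoPath M)
    {e : OpenPartialHomeomorph M (E n)} (he : e ∈ IsManifold.maximalAtlas 𝓘(ℝ, E n) ∞ M)
    {t : unitInterval} {x : M} (hx : x ∈ e.source) :
    generator α φ t x = α.inChart e (e x) ((velocity n φ t).inChart e (e x)) := by
  rw [generator, oneForm_apply_eq_inChart α he hx, VectorField.inChart]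
  exact congrArg (α.inChart e (e x)) (mfderiv_congr_vectorField e (e.left_inv hx).symm _)

variable [IsManifold 𝓘(ℝ, E n) ∞ M]

/-- The generator of a composition: by the chain rule the velocity of `φ_t ψ_t` is
`φ̇_t + (φ_t)_* ψ̇_t`, and `α ((φ_t)_* ψ̇_t) = α (ψ̇_t) ∘ φ_t⁻¹` as `φ_t` preserves `α`. -/
theorem generator_mul_apply {α : OneForm n M} (hφ : IsIsotopy n φ) (hψ : IsIsotopy n ψ)
    (h : PreservesForm α φ) (t : unitInterval) (w : M) :
    generator α (φ * ψ) t (φ.1 t (ψ.1 t w)) =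
      generator α φ t (φ.1 t (ψ.1 t w)) + generator α ψ t (ψ.1 t w) := by
  set u := ψ.1 t w with hu_def
  set e := chartAt (E n) u with he_def
  set e' := chartAt (E n) (φ.1 t u) with he'_def
  have he : e ∈ IsManifold.maximalAtlas 𝓘(ℝ, E n) ∞ M := IsManifold.chart_mem_maximalAtlas _
  have he' : e' ∈ IsManifold.maximalAtlas 𝓘(ℝ, E n) ∞ M := IsManifold.chart_mem_maximalAtlas _
  have hu : u ∈ e.source := mem_chart_source _ _
  have hu' : φ.1 t u ∈ e'.source := mem_chart_source _ _
  set W := repDomain φ e e' with hW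
  set D := fderivWithin ℝ (localRep φ e e') W with hD
  have hmem : (e u, (t : ℝ)) ∈ W := mem_repDomain_chart φ e e' hu hu'
  set c := (velocity n ψ t).inChart e (e u) with hc
  have hVψ : HasDerivWithinAt (fun s => e (evalPath ψ (w, s))) c (Icc 0 1) t :=
    velocity_inChart hψ he (w := w) hu
  have hVmul : HasDerivWithinAt (fun s => e' (evalPath (φ * ψ) (w, s)))
      ((velocity n (φ * ψ) t).inChart e' (e' (φ.1 t u))) (Icc 0 1) t :=
    velocity_inChart (isIsotopy_mul hφ hψ) he' (w := w) hu'
  have hT : {s : ℝ | s ∈ Icc (0 : ℝ) 1 ∧ evalPath ψ (w, s) ∈ e.source ∧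
      evalPath (φ * ψ) (w, s) ∈ e'.source} ∈ 𝓝[Icc 0 1] (t : ℝ) := by
    have h1 : IsOpen {s : ℝ | evalPath ψ (w, s) ∈ e.source} :=
      e.open_source.preimage ((continuous_evalPath ψ).comp (by fun_prop))
    have h2 : IsOpen {s : ℝ | evalPath (φ * ψ) (w, s) ∈ e'.source} :=
      e'.open_source.preimage ((continuous_evalPath (φ * ψ)).comp (by fun_prop))
    have h1t : evalPath ψ (w, (t : ℝ)) ∈ e.source := by rwa [evalPath_coe]
    have h2t : evalPath (φ * ψ) (w, (t : ℝ)) ∈ e'.source := by rwa [evalPath_coe]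
    filter_upwards [self_mem_nhdsWithin, mem_nhdsWithin_of_mem_nhds (h1.mem_nhds h1t),
      mem_nhdsWithin_of_mem_nhds (h2.mem_nhds h2t)] with s hs hs1 hs2 using ⟨hs, hs1, hs2⟩
  have hFd : HasFDerivWithinAt (localRep φ e e') (D (e u, t)) W
      (e (evalPath ψ (w, (t : ℝ))), (t : ℝ)) := by
    rw [evalPath_coe]
    exact ((contDiffOn_localRep hφ he he').differentiableOn (by simp) _ hmem).hasFDerivWithinAt
  have hcurve : HasDerivWithinAt (fun s : ℝ => (e (evalPath ψ (w, s)), s)) (c, (1 : ℝ))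
      {s : ℝ | s ∈ Icc (0 : ℝ) 1 ∧ evalPath ψ (w, s) ∈ e.source ∧
        evalPath (φ * ψ) (w, s) ∈ e'.source} t :=
    (hVψ.prodMk (hasDerivWithinAt_id (t : ℝ) (Icc 0 1))).mono fun s hs => hs.1
  have hcomp := (HasFDerivWithinAt.comp_hasDerivWithinAt
    (f := fun s : ℝ => (e (evalPath ψ (w, s)), s)) (t : ℝ) hFd hcurve fun s hs =>
    ⟨⟨e.map_source hs.2.1, by rw [e.left_inv hs.2.1]; exact hs.2.2⟩,
      mem_univ _, hs.1⟩).mono_of_mem_nhdsWithin hT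
  have hev : ∀ s : ℝ, evalPath ψ (w, s) ∈ e.source → e' (evalPath (φ * ψ) (w, s)) =
      localRep φ e e' (e (evalPath ψ (w, s)), s) := by
    intro s hs
    rw [localRep_chart hs]
    rfl
  have hVD : (velocity n (φ * ψ) t).inChart e' (e' (φ.1 t u)) = D (e u, t) (c, 1) := by
    refine (uniqueDiffOn_Icc zero_lt_one (t : ℝ) t.2).eq_deriv _ hVmul ?_
    refine hcomp.congr_of_eventuallyEq ?_ (hev t (by rwa [evalPath_coe]))
    filter_upwards [hT] with s hs using hev s hs.2.1
  have hsplit : D (e u, t) (c, 1) = D (e u, t) (0, 1) + D (e u, t) (c, 0) := by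
    rw [← map_add]
    simp
  have hc' : c = mfderiv 𝓘(ℝ, E n) 𝓘(ℝ, E n) e u (velocity n ψ t u) :=
    mfderiv_congr_vectorField e (e.left_inv hu) _
  have hpull := pullback_eq_inChart α hφ he he' hu hu' (velocity n ψ t u)
  rw [← hc', localRep_chart hu, evalPath_coe, h t u] at hpull
  rw [generator_eq_inChart α (φ * ψ) he' hu', generator_eq_inChart α φ he' hu', hVD, hsplit,
    map_add, velocity_inChart_eq hφ he he' hu hu', ← hpull]
  rfl

theorem generator_mul {α : OneForm n M} (hφ : IsIsotopy n φ) (hψ : IsIsotopy n ψ)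
    (h : PreservesForm α φ) (t : unitInterval) (x : M) :
    generator α (φ * ψ) t x = generator α φ t x + generator α ψ t ((φ.1 t).symm x) := by
  have := generator_mul_apply hφ hψ h t ((ψ.1 t).symm ((φ.1 t).symm x))
  simpa only [Homeomorph.apply_symm_apply] using this

/-- The composition law for `1 * 1 = 1` says that the generator `g` of `1` satisfies `g = g + g`. -/
theorem generator_one (α : OneForm n M) (t : unitInterval) (x : M) :
    generator α (1 : HomeoPath M) t x = 0 := by
  have h := generator_mul_apply (isIsotopy_one (n := n) (M := M)) isIsotopy_one
    (preservesForm_one α) t x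
  rw [one_mul] at h
  exact left_eq_add.1 h

theorem generator_inv {α : OneForm n M} (hφ : IsIsotopy n φ) (h : PreservesForm α φ)
    (t : unitInterval) (x : M) : generator α φ⁻¹ t x = -generator α φ t (φ.1 t x) := by
  have h1 := generator_mul hφ (isIsotopy_inv hφ) h t (φ.1 t x)
  rw [mul_inv_cancel, generator_one, Homeomorph.symm_apply_apply] at h1
  linarith

end Generator

section Subgroup

variable {n : ℕ} {M : Type*} [MetricSpace M] [CompactSpace M] [ChartedSpace (E n) M]
  [IsManifold 𝓘(ℝ, E n) ∞ M]

theorem mem_QS_iff {α : OneForm n M} (hα : α.IsSmooth) {p : HomeoPath M × L1Infty M} :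
    p ∈ QS α ↔ (IsIsotopy n p.1 ∧ PreservesForm α p.1) ∧
      ∀ᵐ t : unitInterval, ∀ x, p.2 t x = generator α p.1 t x :=
  and_congr_left' (isStrictlyContactIsotopy_iff hα)

/-- The pairs of a strictly contact isotopy and its generator form a subgroup. -/
@[reducible] def QSSubgroup {α : OneForm n M} (hα : α.IsSmooth) :
    letI := pairGroup M
    Subgroup (HomeoPath M × L1Infty M) :=
  letI := pairGroup M
  { carrier := QS α
    mul_mem' := by
      intro p q hp hq
      obtain ⟨⟨hp1, hp2⟩, hp3⟩ := (mem_QS_iff hα).1 hp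
      obtain ⟨⟨hq1, hq2⟩, hq3⟩ := (mem_QS_iff hα).1 hq
      refine (mem_QS_iff hα).2 ⟨⟨isIsotopy_mul hp1 hq1, preservesForm_mul hp1 hq1 hp2 hq2⟩, ?_⟩
      change ∀ᵐ t : unitInterval, ∀ x, (p.2 + compHam q.2 p.1⁻¹ : L1Infty M) t x =
        generator α (p.1 * q.1) t x
      filter_upwards [hp3, hq3, Lp.coeFn_add p.2 (compHam q.2 p.1⁻¹),
        coeFn_compHam q.2 p.1⁻¹] with t h1 h2 h3 h4 x
      rw [h3, Pi.add_apply, h4, ContinuousMap.add_apply, h1, generator_mul hp1 hq1 hp2]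
      exact congrArg _ (h2 _)
    one_mem' := by
      refine (mem_QS_iff hα).2 ⟨⟨isIsotopy_one, preservesForm_one α⟩, ?_⟩
      change ∀ᵐ t : unitInterval, ∀ x, (0 : L1Infty M) t x = generator α (1 : HomeoPath M) t x
      filter_upwards [Lp.coeFn_zero C(M, ℝ) 1 (volume : Measure unitInterval)] with t h x
      rw [h, generator_one]
      rfl
    inv_mem' := by
      intro p hp
      obtain ⟨⟨hp1, hp2⟩, hp3⟩ := (mem_QS_iff hα).1 hp
      refine (mem_QS_iff hα).2 ⟨⟨isIsotopy_inv hp1, preservesForm_inv hp1 hp2⟩, ?_⟩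
      change ∀ᵐ t : unitInterval, ∀ x, (-compHam p.2 p.1 : L1Infty M) t x =
        generator α p.1⁻¹ t x
      filter_upwards [hp3, Lp.coeFn_neg (compHam p.2 p.1), coeFn_compHam p.2 p.1]
        with t h1 h2 h3 x
      rw [h2, Pi.neg_apply, h3, ContinuousMap.neg_apply, generator_inv hp1 hp2]
      exact congrArg _ (h1 _) }

/-- A set which underlies a subgroup is a group, topological if the ambient group is. -/
theorem exists_group_of_coe_eq {X : Type*} [Group X] (S : Subgroup X) {A : Set X}
    (hA : (S : Set X) = A) : ∃ _ : Group A,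
      (∀ p q : A, ((p * q : A) : X) = p * q) ∧ (∀ p : A, ((p⁻¹ : A) : X) = (p : X)⁻¹) ∧
      ∀ [TopologicalSpace X] [IsTopologicalGroup X], IsTopologicalGroup A := by
  subst hA
  exact ⟨S.toGroup, fun _ _ => rfl, fun _ => rfl, inferInstanceAs (IsTopologicalGroup S)⟩

end Subgroup

end ContactTopology

end

open ContactTopology in
theorem theorem2p1 (n : ℕ) {M : Type*} [MetricSpace M] [CompactSpace M]
    [ChartedSpace (E n) M] [IsManifold 𝓘(ℝ, E n) ∞ M] [MeasurableSpace M] [BorelSpace M]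
    (α : OneForm n M) (hα : IsContactForm α) :
    ∃ G : Group (QSbar α),
      (∀ p q : QSbar α,
        (∀ t x, (p * q).1.1.1 t x = p.1.1.1 t (q.1.1.1 t x)) ∧
        (∀ᵐ t : unitInterval, ∀ x,
          (p * q).1.2 t x = p.1.2 t x + q.1.2 t ((p.1.1.1 t).symm x))) ∧
      (∀ p : QSbar α,
        (∀ t x, (p⁻¹).1.1.1 t x = (p.1.1.1 t).symm x) ∧
        (∀ᵐ t : unitInterval, ∀ x, (p⁻¹).1.2 t x = -p.1.2 t (p.1.1.1 t x))) ∧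
      @IsTopologicalGroup (QSbar α) (contactTopologyQSbar α) G ∧
      contactTopologyQSbar α = productTopologyQSbar α := by
  have := isFiniteMeasure_contactVolume hα.smooth
  have hpos : Nonempty M → contactVolume α ≠ 0 := contactVolume_ne_zero hα
  let _ := pairGroup M
  have htg : IsTopologicalGroup (HomeoPath M × L1Infty M) := isTopologicalGroup_pairGroup
  have hbar : ((QSSubgroup hα.smooth).topologicalClosure : Set (HomeoPath M × L1Infty M)) =
      QSbar α := by
    rw [Subgroup.topologicalClosure_coe, QSbar, pairTopology_eq α hpos]
    rfl
  obtain ⟨G, hmul, hinv, hG⟩ := exists_group_of_coe_eq _ hbar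
  have hcont : contactTopologyQSbar α = (inferInstance : TopologicalSpace (QSbar α)) :=
    distTopology_contactDist α hpos (QSbar α)
  have hprod : productTopologyQSbar α = (inferInstance : TopologicalSpace (QSbar α)) := by
    unfold productTopologyQSbar
    rw [pairTopology_eq α hpos]
    rfl
  refine ⟨G, fun p q => ?_, fun p => ?_, ?_, hcont.trans hprod.symm⟩
  · rw [hmul]
    refine ⟨fun _ _ => rfl, ?_⟩
    change ∀ᵐ t : unitInterval, ∀ x, (p.1.2 + compHam q.1.2 p.1.1⁻¹ : L1Infty M) t x =
      p.1.2 t x + q.1.2 t ((p.1.1.1 t).symm x)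
    filter_upwards [Lp.coeFn_add p.1.2 (compHam q.1.2 p.1.1⁻¹),
      coeFn_compHam q.1.2 p.1.1⁻¹] with t h1 h2 x
    rw [h1, Pi.add_apply, h2]
    rfl
  · rw [hinv]
    refine ⟨fun _ _ => rfl, ?_⟩
    change ∀ᵐ t : unitInterval, ∀ x, (-compHam p.1.2 p.1.1 : L1Infty M) t x =
      -p.1.2 t (p.1.1.1 t x)
    filter_upwards [Lp.coeFn_neg (compHam p.1.2 p.1.1), coeFn_compHam p.1.2 p.1.1] with t h1 h2 x
    rw [h1, Pi.neg_apply, h2]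
    rfl
  · rw [hcont]
    exact hG
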